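/- A \emph{polyomino} is a nonempty finite union of closed unit cells of the square lattice that is connected and has no cut point (i.e. it is connected through common edges of its cells); it is \emph{convex} if each of its rows and each of its columns is connected. Let $P$ be a polyomino without holes having $n-1\ge 1$ rows and $n-1$ columns, placed so that the south-west corner of its minimal bounding rectangle is $(1,1)$, and let $A_1,A_2,\dots,A_{2(r+1)}$ be the vertices (corners of the boundary) of $P$ in clockwise order, starting from the lowest leftmost vertex. $P$ is a \emph{permutomino of size $n$} if $\{A_1,A_3,\dots,A_{2r+1}\}=\{(i,\pi_1(i)):1\le i\le n\}$ and $\{A_2,A_4,\dots,A_{2r+2}\}=\{(i,\pi_2(i)):1\le i\le n\}$ for two permutations $\pi_1=\pi_1(P)$, $\pi_2=\pi_2(P)$ in $\mathcal S_n$. By convention, there is also the empty permutomino of size $1$, which is convex and has $\pi_1=(1)$. Let $\widetilde{\mathcal C}_n\subseteq\mathcal S_n$ be the set of the permutations $\pi_1(P)$, where $P$ is a convex permutomino of size $n$. For $\pi\in\mathcal S_n$, an entry $\pi(j)$ is a left-right maximum (respectively, a right-left maximum) if $\pi(j)>\pi(i)$ for all $i<j$ (respectively, for all $i>j$). Let $\mu(\pi)$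 be the subsequence of $\pi$ formed by the left-right maxima followed by the right-left maxima (the maximal upper unimodal sublist of $\pi$), and let $\sigma(\pi)$ be the subsequence of $\pi$ formed by the first entry $\pi(1)$, the last entry $\pi(n)$ and all entries that do not belong to $\mu(\pi)$. A sequence is \emph{lower unimodal} if it is strictly decreasing and then strictly increasing, where either part may be missing. For $\theta\in\mathcal S_m$ and $\theta'\in\mathcal S_{m'}$, the \emph{direct difference} is $$\theta\ominus\theta'=(\theta_1+m',\dots,\theta_m+m',\theta'_1,\dots,\theta'_{m'})\in\mathcal S_{m+m'}.$$ \textbf{Theorem.} Let $n\ge 1$ and $\pi\in\mathcal S_n$. Then $\pi\in\widetilde{\mathcal C}_n$ if and only if 1. $\sigma(\pi)$ is lower unimodal, and 2. there are no $m,m'\ge 1$ with $m+m'=n$ and permutations $\theta\in\mathcal S_m$, $\theta'\in\mathcal S_{m'}$ such that $\pi=\theta\ominus\theta'$. -/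

import Mathlib

/-! ## Polyominoes

The cell `(x, y) : ℤ × ℤ` is the closed unit square `[x, x + 1] × [y, y + 1]`; a finite union of cells
is given by its finite set of cells. -/

namespace Permutomino

/-- Two cells share an edge. -/
def CellAdj (c d : ℤ × ℤ) : Prop :=
  |c.1 - d.1| + |c.2 - d.2| = 1

/-- Any two cells of `S` are joined by a path of cells of `S`, consecutive ones sharing an edge. -/
def EdgeConnected (S : Set (ℤ × ℤ)) : Prop :=
  ∀ a ∈ S, ∀ b ∈ S, Relation.ReflTransGen (fun c d => CellAdj c d ∧ d ∈ S) a b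

/-- A polyomino: a nonempty finite union of cells that is connected without cut points, that is,
connected through common edges of cells. -/
def IsPolyomino (P : Finset (ℤ × ℤ)) : Prop :=
  P.Nonempty ∧ EdgeConnected (P : Set (ℤ × ℤ))

/-- The complement of the polyomino is connected. -/
def HasNoHoles (P : Finset (ℤ × ℤ)) : Prop :=
  EdgeConnected {c : ℤ × ℤ | c ∉ P}

/-- Every row is connected. -/
def IsRowConvex (P : Finset (ℤ × ℤ)) : Prop :=
  ∀ y : ℤ, {x : ℤ | (x, y) ∈ P}.OrdConnected

/-- Every column is connected. -/
def IsColumnConvex (P : Finset (ℤ × ℤ)) : Prop :=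
  ∀ x : ℤ, {y : ℤ | (x, y) ∈ P}.OrdConnected

/-! ### The boundary and its vertices -/

/-- The lattice segment from `(x, y)` to `(x, y + 1)` lies on the boundary: exactly one of the two
cells beside it belongs to `P`. -/
def VerticalEdge (P : Finset (ℤ × ℤ)) (x y : ℤ) : Prop :=
  Xor ((x - 1, y) ∈ P) ((x, y) ∈ P)

/-- The lattice segment from `(x, y)` to `(x + 1, y)` lies on the boundary. -/
def HorizontalEdge (P : Finset (ℤ × ℤ)) (x y : ℤ) : Prop :=
  Xor ((x, y - 1) ∈ P) ((x, y) ∈ P)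

/-- The lattice point `p` is a vertex of `P` (a corner of its boundary): a vertical and a horizontal
boundary edge meet at `p`. -/
def IsVertex (P : Finset (ℤ × ℤ)) (p : ℤ × ℤ) : Prop :=
  (VerticalEdge P p.1 p.2 ∨ VerticalEdge P p.1 (p.2 - 1)) ∧
    (HorizontalEdge P p.1 p.2 ∨ HorizontalEdge P (p.1 - 1) p.2)

/-- The segment from `p` to `q` goes straight north, east, south or west along the boundary of `P` in
the clockwise sense: the cells on its right belong to `P`, those on its left do not. -/
def IsClockwiseSide (P : Finset (ℤ × ℤ)) (p q : ℤ × ℤ) : Prop :=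
  (p.1 = q.1 ∧ p.2 < q.2 ∧ ∀ y, p.2 ≤ y → y < q.2 → (p.1, y) ∈ P ∧ (p.1 - 1, y) ∉ P) ∨
  (p.2 = q.2 ∧ p.1 < q.1 ∧ ∀ x, p.1 ≤ x → x < q.1 → (x, p.2 - 1) ∈ P ∧ (x, p.2) ∉ P) ∨
  (p.1 = q.1 ∧ q.2 < p.2 ∧ ∀ y, q.2 ≤ y → y < p.2 → (p.1 - 1, y) ∈ P ∧ (p.1, y) ∉ P) ∨
  (p.2 = q.2 ∧ q.1 < p.1 ∧ ∀ x, q.1 ≤ x → x < p.1 → (x, p.2) ∈ P ∧ (x, p.2 - 1) ∉ P)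

/-- `A` is the list of all the vertices of `P`, each listed once, in clockwise order along the boundary,
starting from the lowest leftmost vertex (the indices start from `0` and are read cyclically). -/
structure IsVertexList (P : Finset (ℤ × ℤ)) {r : ℕ} (A : Fin (2 * r + 2) → ℤ × ℤ) : Prop where
  injective : Function.Injective A
  mem_iff : ∀ p, (∃ i, A i = p) ↔ IsVertex P p
  side : ∀ i, IsClockwiseSide P (A i) (A (i + 1))
  leftmost : ∀ i, (A 0).1 ≤ (A i).1
  lowest : ∀ i, (A i).1 = (A 0).1 → (A 0).2 ≤ (A i).2

/-! ### Permutominoes -/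

/-- The points `(i, π i)`, `1 ≤ i ≤ n`, of a permutation of `{1, …, n}`, here encoded as a permutation
of `Fin n = {0, …, n - 1}`. -/
def points {n : ℕ} (π : Equiv.Perm (Fin n)) : Set (ℤ × ℤ) :=
  {p | ∃ i : Fin n, p = (((i : ℕ) : ℤ) + 1, ((π i : ℕ) : ℤ) + 1)}

/-- `P` is a permutomino of size `n` with `π₁(P) = π₁` and `π₂(P) = π₂`. Either it is a polyomino without
holes, with `n - 1` rows and columns, the south-west corner of its minimal bounding rectangle being
`(1, 1)`, such that the first, third, fifth, ... of its vertices represent `π₁` and the second, fourth,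
sixth, ... represent `π₂`; or it is the empty permutomino, which has size `1`. -/
def IsPermutomino {n : ℕ} (P : Finset (ℤ × ℤ)) (π₁ π₂ : Equiv.Perm (Fin n)) : Prop :=
  (P = ∅ ∧ n = 1) ∨
  (IsPolyomino P ∧ HasNoHoles P ∧
    P.image Prod.fst = Finset.Icc (1 : ℤ) ((n : ℤ) - 1) ∧
    P.image Prod.snd = Finset.Icc (1 : ℤ) ((n : ℤ) - 1) ∧
    ∃ (r : ℕ) (A : Fin (2 * r + 2) → ℤ × ℤ), IsVertexList P A ∧
      {p | ∃ i : Fin (2 * r + 2), Even (i : ℕ) ∧ A i = p} = points π₁ ∧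
      {p | ∃ i : Fin (2 * r + 2), Odd (i : ℕ) ∧ A i = p} = points π₂)

/-- The set of the permutations `π₁(P)`, where `P` is a convex permutomino of size `n`. -/
def convexPermutominoPerms (n : ℕ) : Set (Equiv.Perm (Fin n)) :=
  {π | ∃ (P : Finset (ℤ × ℤ)) (π₂ : Equiv.Perm (Fin n)),
    IsPermutomino P π π₂ ∧ IsRowConvex P ∧ IsColumnConvex P}

/-! ## Permutations -/

/-- The entry of `π` at `j` is a left-right maximum. -/
def IsLeftRightMax {n : ℕ} (π : Equiv.Perm (Fin n)) (j : Fin n) : Prop :=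
  ∀ i, i < j → π i < π j

/-- The entry of `π` at `j` is a right-left maximum. -/
def IsRightLeftMax {n : ℕ} (π : Equiv.Perm (Fin n)) (j : Fin n) : Prop :=
  ∀ i, j < i → π i < π j

/-- The entry of `π` at `j` belongs to the maximal upper unimodal sublist `μ(π)`, which consists of the
left-right maxima followed by the right-left maxima. -/
def InMu {n : ℕ} (π : Equiv.Perm (Fin n)) (j : Fin n) : Prop :=
  IsLeftRightMax π j ∨ IsRightLeftMax π j

/-- The entry of `π` at `j` belongs to `σ(π)`: it is the first entry, or the last one, or it does not
belong to `μ(π)`. -/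
def InSigma {n : ℕ} (π : Equiv.Perm (Fin n)) (j : Fin n) : Prop :=
  (j : ℕ) = 0 ∨ (j : ℕ) + 1 = n ∨ ¬ InMu π j

open Classical in
/-- The subsequence `σ(π)` of `π = (π 0, …, π (n - 1))`. -/
noncomputable def sigma {n : ℕ} (π : Equiv.Perm (Fin n)) : List (Fin n) :=
  ((List.finRange n).filter (fun j => decide (InSigma π j))).map π

/-- A sequence is lower unimodal if it is strictly decreasing and then strictly increasing (either part
may be missing). -/
def LowerUnimodal {α : Type*} [LT α] (l : List α) : Prop :=
  ∃ l₁ l₂ : List α, l = l₁ ++ l₂ ∧ l₁.Pairwise (· > ·) ∧ l₂.Pairwise (· < ·)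

/-- The direct difference `θ ⊖ θ' = (θ 0 + m', …, θ (m - 1) + m', θ' 0, …, θ' (m' - 1))`. -/
def directDifference {m m' : ℕ} (θ : Equiv.Perm (Fin m)) (θ' : Equiv.Perm (Fin m')) :
    Equiv.Perm (Fin (m + m')) :=
  finSumFinEquiv.symm.trans <| (Equiv.sumCongr θ θ').trans <|
    (Equiv.sumComm (Fin m) (Fin m')).trans <| finSumFinEquiv.trans <| finCongr (Nat.add_comm m' m)

theorem directDifference_castAdd {m m' : ℕ} (θ : Equiv.Perm (Fin m)) (θ' : Equiv.Perm (Fin m'))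
    (i : Fin m) : (directDifference θ θ' (Fin.castAdd m' i) : ℕ) = (θ i : ℕ) + m' := by
  simp [directDifference, Nat.add_comm]

theorem directDifference_natAdd {m m' : ℕ} (θ : Equiv.Perm (Fin m)) (θ' : Equiv.Perm (Fin m'))
    (i : Fin m') : (directDifference θ θ' (Fin.natAdd m i) : ℕ) = (θ' i : ℕ) := by
  simp [directDifference]

/-- `π` is the direct difference of two (nonempty) permutations. -/
def IsDirectDifference {n : ℕ} (π : Equiv.Perm (Fin n)) : Prop :=
  ∃ (m m' : ℕ) (_ : 0 < m) (_ : 0 < m') (h : m + m' = n) (θ : Equiv.Perm (Fin m))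
    (θ' : Equiv.Perm (Fin m')), π = (finCongr h).permCongr (directDifference θ θ')

end Permutomino

/-!
Both sides of the equivalence say that `π` is a *square* permutation (every entry is a left-right or
right-left maximum or minimum) that is not a direct difference. That `σ(π)` is lower unimodal exactly
when `π` is square is elementary (`lowerUnimodal_sigma_iff_isSquarePerm`): `σ(π)` retains the first and
the last entry, which suffice to detect an entry outside `μ(π)` with smaller entries on both sides.

The link between the polyomino and the permutations is the *crossing rule* (`CrossingRule`): since the
sides are alternately vertical and horizontal and each vertical line carries just one vertex of `π₁` and
one of `π₂`, the boundary on the line `i` is the segment from `(i, π₁ i)` to `(i, π₂ i)`, traversed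
clockwise. So the entries of `π₁` and `π₂` at `i` tell how column `i` of `P` differs from column `i - 1`.

From a convex permutomino to its permutation: there are four patterns of cells around the
vertex `(i, π₁ i)`, and in each of them convexity makes it impossible to leave one of the four quadrants
at that vertex within `P`. As `P` is connected, this quadrant is empty, which makes the entry at `i` a
record of one of the four kinds (`CrossingRule.isSquarePerm`). If `π₁` were a direct difference with cut
`m`, then a row through column `m` would continue for ever to the west or to the east
(`CrossingRule.exists_le_of_column_nonempty`).

Conversely, for a square permutation let column `x` of `P` reach from the last entry up to line `x` that
is not in `μ(π)` (or the first entry) to the first entry of `μ(π)` beyond line `x`. The column is nonempty,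
for otherwise the entries up to line `x` would exceed all the others (`IsBottomAt.height_lt`). The
vertices are visited along the entries of `μ(π)` from left to right and then along the remaining ones
from right to left (`exists_tour`), and this yields `π₂`.
-/

namespace Permutomino

/-! ### Lower unimodal sequences and square permutations -/

theorem LowerUnimodal.sublist {α : Type*} [LT α] {l l' : List α} (h : LowerUnimodal l)
    (hs : l'.Sublist l) : LowerUnimodal l' := by
  obtain ⟨l₁, l₂, rfl, h₁, h₂⟩ := h
  obtain ⟨k₁, k₂, rfl, hk₁, hk₂⟩ := List.sublist_append_iff.1 hs
  exact ⟨k₁, k₂, rfl, h₁.sublist hk₁, h₂.sublist hk₂⟩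

theorem LowerUnimodal.lt_or_lt {α : Type*} [LT α] {l : List α} {a b c : α}
    (h : LowerUnimodal l) (hs : [a, b, c].Sublist l) : b < a ∨ b < c := by
  obtain ⟨l₁, l₂, he, h₁, h₂⟩ := h.sublist hs
  rcases l₁ with _ | ⟨x, _ | ⟨y, l₁⟩⟩
  · simp only [List.nil_append] at he
    subst he
    simp at h₂
    exact Or.inr h₂.2
  · simp only [List.cons_append, List.nil_append, List.cons.injEq] at he
    obtain ⟨rfl, rfl⟩ := he
    simp at h₂
    exact Or.inr h₂
  · simp only [List.cons_append, List.cons.injEq] at he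
    obtain ⟨rfl, rfl, -⟩ := he
    simp at h₁
    exact Or.inl h₁.1.1

theorem lowerUnimodal_of_forall_sublist {α : Type*} [LinearOrder α] {l : List α} (hl : l.Nodup)
    (h : ∀ a b c, [a, b, c].Sublist l → b < a ∨ b < c) : LowerUnimodal l := by
  induction l with
  | nil => exact ⟨[], [], rfl, List.Pairwise.nil, List.Pairwise.nil⟩
  | cons a l ih =>
    obtain ⟨l₁, l₂, rfl, h₁, h₂⟩ :=
      ih hl.of_cons fun x y z hs => h x y z (hs.trans (List.sublist_cons_self _ _))
    have cons_inc : ∀ (x y : α) (t : List α), x < y → (y :: t).Pairwise (· < ·) →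
        (x :: y :: t).Pairwise (· < ·) := by
      intro x y t hxy ht
      refine List.pairwise_cons.2 ⟨fun z hz => ?_, ht⟩
      rcases List.mem_cons.1 hz with rfl | hz
      · exact hxy
      · exact hxy.trans ((List.pairwise_cons.1 ht).1 z hz)
    have cons_dec : ∀ (x y : α) (t : List α), y < x → (y :: t).Pairwise (· > ·) →
        (x :: y :: t).Pairwise (· > ·) := by
      intro x y t hxy ht
      refine List.pairwise_cons.2 ⟨fun z hz => ?_, ht⟩
      rcases List.mem_cons.1 hz with rfl | hz
      · exact hxy
      · exact ((List.pairwise_cons.1 ht).1 z hz).trans hxy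
    rcases l₁ with _ | ⟨b, l₁⟩
    · exact ⟨[a], l₂, rfl, by simp, h₂⟩
    · have hab : a ≠ b := by
        rintro rfl
        simp at hl
      rcases lt_or_gt_of_ne hab with hab | hab
      · rcases l₁ with _ | ⟨c, l₁⟩
        · rcases l₂ with _ | ⟨c, l₂⟩
          · exact ⟨[], [a, b], rfl, List.Pairwise.nil, by simpa using hab⟩
          · have hbc : b < c := (h a b c (by simp)).resolve_left hab.not_gt
            exact ⟨[], a :: b :: c :: l₂, rfl, List.Pairwise.nil,
              cons_inc _ _ _ hab (cons_inc _ _ _ hbc h₂)⟩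
        · -- here `a < b > c`, which the hypothesis forbids
          have hbc : c < b := (List.pairwise_cons.1 h₁).1 c (by simp)
          rcases h a b c (by simp) with h' | h'
          · exact absurd h' hab.not_gt
          · exact absurd h' hbc.not_gt
      · exact ⟨a :: b :: l₁, l₂, rfl, cons_dec _ _ _ hab h₁, h₂⟩

/-- The entry of `π` at `j` is a left-right minimum. -/
def IsLeftRightMin {n : ℕ} (π : Equiv.Perm (Fin n)) (j : Fin n) : Prop :=
  ∀ i, i < j → π j < π i

/-- The entry of `π` at `j` is a right-left minimum. -/
def IsRightLeftMin {n : ℕ} (π : Equiv.Perm (Fin n)) (j : Fin n) : Prop :=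
  ∀ i, j < i → π j < π i

/-- A square permutation: every entry is a record (a maximum or a minimum) from the left or from the
right. -/
def IsSquarePerm {n : ℕ} (π : Equiv.Perm (Fin n)) : Prop :=
  ∀ j, InMu π j ∨ IsLeftRightMin π j ∨ IsRightLeftMin π j

theorem lowerUnimodal_sigma_iff {n : ℕ} (π : Equiv.Perm (Fin n)) :
    LowerUnimodal (sigma π) ↔ ∀ i j k, i < j → j < k → InSigma π i → InSigma π j → InSigma π k →
      π j < π i ∨ π j < π k := by
  classical
  have hp : ((List.finRange n).filter (fun j => decide (InSigma π j))).Pairwise (· < ·) :=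
    (List.pairwise_lt_finRange n).sublist List.filter_sublist
  constructor
  · intro h i j k hij hjk hi hj hk
    refine h.lt_or_lt (a := π i) (c := π k) ?_
    have : [i, j, k].Sublist ((List.finRange n).filter (fun j => decide (InSigma π j))) := by
      apply List.sublist_of_subperm_of_pairwise (r := (· < ·)) _ (by simp [hij, hjk, hij.trans hjk]) hp
      refine List.subperm_of_subset (by simp [hij.ne, hjk.ne, (hij.trans hjk).ne]) ?_
      intro x hx
      simp at hx
      rcases hx with rfl | rfl | rfl <;> simp [hi, hj, hk]
    unfold sigma
    simpa using this.map π
  · intro h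
    refine lowerUnimodal_of_forall_sublist ?_ ?_
    · unfold sigma
      exact List.Nodup.map π.injective ((List.nodup_finRange n).filter _)
    · intro a b c hs
      unfold sigma at hs
      obtain ⟨l, hl, he⟩ := List.sublist_map_iff.1 hs
      obtain ⟨i, l, rfl, rfl, he₁⟩ := List.map_eq_cons_iff.1 he.symm
      obtain ⟨j, l, rfl, rfl, he₂⟩ := List.map_eq_cons_iff.1 he₁
      obtain ⟨k, l, rfl, rfl, he₃⟩ := List.map_eq_cons_iff.1 he₂
      obtain rfl := List.map_eq_nil_iff.1 he₃
      have hl' := (List.pairwise_lt_finRange n).sublist (hl.trans List.filter_sublist)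
      simp at hl'
      have hm : ∀ x ∈ [i, j, k], InSigma π x := fun x hx => by
        simpa using (List.mem_filter.1 (hl.subset hx)).2
      exact h i j k hl'.1.1 hl'.2 (hm i (by simp)) (hm j (by simp)) (hm k (by simp))

/-- If an entry outside `μ(π)` has smaller entries on both sides, then smaller entries of `σ(π)` can be
found on both sides: a smaller left-right maximum on the left can be replaced with the first entry, a
smaller right-left maximum on the right with the last one. -/
theorem lowerUnimodal_sigma_iff_isSquarePerm {n : ℕ} (π : Equiv.Perm (Fin n)) :
    LowerUnimodal (sigma π) ↔ IsSquarePerm π := by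
  rw [lowerUnimodal_sigma_iff]
  constructor
  · intro h j
    by_contra! hc
    obtain ⟨hmu, hl, hr⟩ := hc
    simp only [IsLeftRightMin, IsRightLeftMin, not_forall, not_lt] at hl hr
    obtain ⟨i, hij, hi⟩ := hl
    obtain ⟨k, hjk, hk⟩ := hr
    have hi : π i < π j := lt_of_le_of_ne hi fun h => hij.ne (π.injective h)
    have hk : π k < π j := lt_of_le_of_ne hk fun h => hjk.ne' (π.injective h)
    have hi' : ∃ i', i' < j ∧ π i' < π j ∧ InSigma π i' := by
      by_cases hmi : InMu π i
      · rcases hmi with hm | hm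
        · have hn : 0 < n := i.pos
          refine ⟨⟨0, hn⟩, lt_of_le_of_lt (Fin.mk_le_of_le_val (Nat.zero_le _)) hij, ?_, Or.inl rfl⟩
          rcases (Fin.mk_le_of_le_val (Nat.zero_le _) : (⟨0, hn⟩ : Fin n) ≤ i).eq_or_lt with h0 | h0
          · rwa [h0]
          · exact (hm _ h0).trans hi
        · exact absurd (hm j hij) hi.not_gt
      · exact ⟨i, hij, hi, Or.inr (Or.inr hmi)⟩
    have hk' : ∃ k', j < k' ∧ π k' < π j ∧ InSigma π k' := by
      by_cases hmk : InMu π k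
      · rcases hmk with hm | hm
        · exact absurd (hm j hjk) hk.not_gt
        · have hn : n - 1 < n := Nat.sub_lt k.pos one_pos
          have hle : k ≤ ⟨n - 1, hn⟩ := Fin.le_def.2 (by simp; omega)
          refine ⟨⟨n - 1, hn⟩, lt_of_lt_of_le hjk hle, ?_, Or.inr (Or.inl (by simp; omega))⟩
          rcases hle.eq_or_lt with h0 | h0
          · rwa [← h0]
          · exact (hm _ h0).trans hk
      · exact ⟨k, hjk, hk, Or.inr (Or.inr hmk)⟩
    obtain ⟨i', hi1, hi2, hi3⟩ := hi'
    obtain ⟨k', hk1, hk2, hk3⟩ := hk'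
    rcases h i' j k' hi1 hk1 hi3 (Or.inr (Or.inr hmu)) hk3 with h | h
    · exact h.not_gt hi2
    · exact h.not_gt hk2
  · intro h i j k hij hjk _ hj _
    rcases hj with hj | hj | hj
    · have := Fin.lt_def.1 hij
      omega
    · have := Fin.lt_def.1 hjk
      omega
    · rcases (h j).resolve_left hj with h | h
      · exact Or.inl (h i hij)
      · exact Or.inr (h k hjk)

/-! ### Direct differences -/

/-- A direct difference is a permutation whose first `m` entries exceed all the others, for some `m`
with `0 < m < n`. -/
theorem isDirectDifference_iff {n : ℕ} (π : Equiv.Perm (Fin n)) :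
    IsDirectDifference π ↔
      ∃ m, 0 < m ∧ m < n ∧ ∀ i j : Fin n, (i : ℕ) < m → m ≤ (j : ℕ) → π j < π i := by
  constructor
  · rintro ⟨m, m', hm, hm', rfl, θ, θ', rfl⟩
    refine ⟨m, hm, by omega, fun i j hi hj => ?_⟩
    have h₁ := directDifference_castAdd θ θ' ⟨i, hi⟩
    have h₂ := directDifference_natAdd θ θ' ⟨(j : ℕ) - m, by omega⟩
    have hi' : Fin.castAdd m' ⟨i, hi⟩ = i := rfl
    have hj' : Fin.natAdd m (⟨(j : ℕ) - m, by omega⟩ : Fin m') = j := by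
      ext
      simp
      omega
    rw [hi'] at h₁
    rw [hj'] at h₂
    have := (θ' ⟨(j : ℕ) - m, by omega⟩).isLt
    simp only [finCongr_refl, Equiv.permCongr_def, Equiv.refl_symm, Equiv.trans_refl,
      Equiv.refl_trans, Fin.lt_def]
    omega
  · rintro ⟨m, hm, hmn, h⟩
    obtain ⟨m', rfl⟩ := Nat.exists_eq_add_of_lt hmn
    set k := m' + 1 with hk
    change Equiv.Perm (Fin (m + k)) at π
    have hge : ∀ i : Fin m, k ≤ (π (Fin.castAdd k i) : ℕ) := fun i => by
      have := Fintype.card_le_of_injective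
        (fun j : Fin k => (⟨π (Fin.natAdd m j), h (Fin.castAdd k i) (Fin.natAdd m j)
          (by simp) (by simp)⟩ : Fin (π (Fin.castAdd k i) : ℕ)))
        (fun a b hab => by
          have := π.injective (Fin.ext (Fin.mk.inj_iff.1 hab))
          simpa [Fin.ext_iff] using this)
      simpa using this
    have hlt : ∀ j : Fin k, (π (Fin.natAdd m j) : ℕ) < k := fun j => by
      have hb : ∀ i : Fin m, (π (Fin.castAdd k i) : ℕ) - (π (Fin.natAdd m j) : ℕ) - 1 <
          m + k - 1 - (π (Fin.natAdd m j) : ℕ) := fun i => by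
        have h₁ : (π (Fin.natAdd m j) : ℕ) < π (Fin.castAdd k i) :=
          h (Fin.castAdd k i) (Fin.natAdd m j) (by simp) (by simp)
        have h₂ := (π (Fin.castAdd k i)).isLt
        omega
      have := Fintype.card_le_of_injective
        (fun i : Fin m => (⟨_, hb i⟩ : Fin (m + k - 1 - (π (Fin.natAdd m j) : ℕ))))
        (fun a b hab => by
          have h₁ : (π (Fin.natAdd m j) : ℕ) < π (Fin.castAdd k a) :=
            h (Fin.castAdd k a) (Fin.natAdd m j) (by simp) (by simp)
          have h₂ : (π (Fin.natAdd m j) : ℕ) < π (Fin.castAdd k b) :=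
            h (Fin.castAdd k b) (Fin.natAdd m j) (by simp) (by simp)
          have h₃ := Fin.mk.inj_iff.1 hab
          have := π.injective (Fin.ext (by omega : (π (Fin.castAdd k a) : ℕ) = π (Fin.castAdd k b)))
          simpa [Fin.ext_iff] using this)
      simp at this
      omega
    have bij : ∀ {l : ℕ} (f : Fin l → Fin l), Function.Injective f → Function.Bijective f :=
      fun f hf => Finite.injective_iff_bijective.1 hf
    have hinj₁ : Function.Injective (fun i : Fin m =>
        (⟨(π (Fin.castAdd k i) : ℕ) - k, by omega⟩ : Fin m)) := fun a b hab => by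
      have h₁ := hge a
      have h₂ := hge b
      have h₃ := Fin.mk.inj_iff.1 hab
      have := π.injective (Fin.ext (by omega : (π (Fin.castAdd k a) : ℕ) = π (Fin.castAdd k b)))
      simpa [Fin.ext_iff] using this
    have hinj₂ : Function.Injective (fun j : Fin k =>
        (⟨(π (Fin.natAdd m j) : ℕ), hlt j⟩ : Fin k)) := fun a b hab => by
      have := π.injective (Fin.ext (Fin.mk.inj_iff.1 hab))
      simpa [Fin.ext_iff] using this
    refine ⟨m, k, hm, by omega, rfl, Equiv.ofBijective _ (bij _ hinj₁),
      Equiv.ofBijective _ (bij _ hinj₂), ?_⟩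
    ext i
    change (π i : ℕ) = (directDifference _ _ i : ℕ)
    induction i using Fin.addCases with
    | left i =>
      rw [directDifference_castAdd]
      have := hge i
      simp
      omega
    | right j =>
      rw [directDifference_natAdd]
      simp

/-! ### Cells around lattice points -/

theorem cellAdj_iff (c d : ℤ × ℤ) : CellAdj c d ↔
    d = (c.1 + 1, c.2) ∨ d = (c.1 - 1, c.2) ∨ d = (c.1, c.2 + 1) ∨ d = (c.1, c.2 - 1) := by
  obtain ⟨a, b⟩ := c
  obtain ⟨a', b'⟩ := d
  simp only [CellAdj, Prod.mk.injEq]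
  grind

/-- The cells beside the last unit step of a clockwise side. -/
theorem IsClockwiseSide.arrival {P : Finset (ℤ × ℤ)} {p q : ℤ × ℤ} (h : IsClockwiseSide P p q) :
    (p.1 = q.1 ∧ p.2 ≠ q.2 ∧ ((q.1, q.2 - 1) ∈ P ∧ (q.1 - 1, q.2 - 1) ∉ P ∨
        (q.1 - 1, q.2) ∈ P ∧ (q.1, q.2) ∉ P)) ∨
      (p.2 = q.2 ∧ p.1 ≠ q.1 ∧ ((q.1 - 1, q.2 - 1) ∈ P ∧ (q.1 - 1, q.2) ∉ P ∨
        (q.1, q.2) ∈ P ∧ (q.1, q.2 - 1) ∉ P)) := by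
  rcases h with ⟨e, hlt, h⟩ | ⟨e, hlt, h⟩ | ⟨e, hlt, h⟩ | ⟨e, hlt, h⟩
  · exact Or.inl ⟨e, hlt.ne, Or.inl (e ▸ h (q.2 - 1) (by omega) (by omega))⟩
  · exact Or.inr ⟨e, hlt.ne, Or.inl (e ▸ h (q.1 - 1) (by omega) (by omega))⟩
  · exact Or.inl ⟨e, hlt.ne', Or.inr (e ▸ h q.2 (by omega) (by omega))⟩
  · exact Or.inr ⟨e, hlt.ne', Or.inr (e ▸ h q.1 (by omega) (by omega))⟩

/-- The cells beside the first unit step of a clockwise side. -/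
theorem IsClockwiseSide.departure {P : Finset (ℤ × ℤ)} {p q : ℤ × ℤ} (h : IsClockwiseSide P p q) :
    (p.1 = q.1 ∧ p.2 ≠ q.2 ∧ ((p.1, p.2) ∈ P ∧ (p.1 - 1, p.2) ∉ P ∨
        (p.1 - 1, p.2 - 1) ∈ P ∧ (p.1, p.2 - 1) ∉ P)) ∨
      (p.2 = q.2 ∧ p.1 ≠ q.1 ∧ ((p.1, p.2 - 1) ∈ P ∧ (p.1, p.2) ∉ P ∨
        (p.1 - 1, p.2) ∈ P ∧ (p.1 - 1, p.2 - 1) ∉ P)) := by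
  rcases h with ⟨e, hlt, h⟩ | ⟨e, hlt, h⟩ | ⟨e, hlt, h⟩ | ⟨e, hlt, h⟩
  · exact Or.inl ⟨e, hlt.ne, Or.inl (h p.2 (by omega) (by omega))⟩
  · exact Or.inr ⟨e, hlt.ne, Or.inl (h p.1 (by omega) (by omega))⟩
  · exact Or.inl ⟨e, hlt.ne', Or.inr (h (p.2 - 1) (by omega) (by omega))⟩
  · exact Or.inr ⟨e, hlt.ne', Or.inr (h (p.1 - 1) (by omega) (by omega))⟩

/-- The boundary turns at a vertex: a side that follows a vertical one is horizontal. -/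
theorem IsClockwiseSide.horizontal_of_vertical {P : Finset (ℤ × ℤ)} {p q s : ℤ × ℤ}
    (h₁ : IsClockwiseSide P p q) (h₂ : IsClockwiseSide P q s) (hq : IsVertex P q)
    (h : p.1 = q.1) : q.2 = s.2 := by
  have a := h₁.arrival
  have b := h₂.departure
  simp only [IsVertex, VerticalEdge, HorizontalEdge, Xor] at hq
  grind

theorem IsClockwiseSide.vertical_of_horizontal {P : Finset (ℤ × ℤ)} {p q s : ℤ × ℤ}
    (h₁ : IsClockwiseSide P p q) (h₂ : IsClockwiseSide P q s) (hq : IsVertex P q)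
    (h : p.2 = q.2) : q.1 = s.1 := by
  have a := h₁.arrival
  have b := h₂.departure
  simp only [IsVertex, VerticalEdge, HorizontalEdge, Xor] at hq
  grind

theorem exists_abs_snd_lt (P : Finset (ℤ × ℤ)) : ∃ M : ℕ, ∀ c ∈ P, |c.2| < M := by
  refine ⟨P.sup (fun c => c.2.natAbs) + 1, fun c hc => ?_⟩
  have : c.2.natAbs ≤ P.sup (fun c => c.2.natAbs) := Finset.le_sup (f := fun c => c.2.natAbs) hc
  rw [Int.abs_eq_natAbs]
  omega

/-- A straight piece of the boundary ends in a vertex; here, its upper end. -/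
theorem VerticalEdge.exists_vertex_above {P : Finset (ℤ × ℤ)} {x y : ℤ} (h : VerticalEdge P x y) :
    ∃ y', y < y' ∧ IsVertex P (x, y') := by
  by_contra! hc
  have hk : ∀ k : ℕ, VerticalEdge P x (y + k) := by
    intro k
    induction k with
    | zero => simpa using h
    | succ k ih =>
      have hv := hc (y + k + 1) (by omega)
      push_cast
      rw [← add_assoc]
      simp only [IsVertex, VerticalEdge, HorizontalEdge, Xor, add_sub_cancel_right] at hv ih ⊢
      grind
  obtain ⟨M, hM⟩ := exists_abs_snd_lt P
  have hm : ∃ x', (x', y + ((M + y.natAbs : ℕ) : ℤ)) ∈ P := by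
    rcases hk (M + y.natAbs) with h | h
    exacts [⟨_, h.1⟩, ⟨_, h.1⟩]
  obtain ⟨x', hx⟩ := hm
  have := hM _ hx
  simp only [abs_lt] at this
  omega

theorem VerticalEdge.exists_vertex_below {P : Finset (ℤ × ℤ)} {x y : ℤ} (h : VerticalEdge P x y) :
    ∃ y', y' ≤ y ∧ IsVertex P (x, y') := by
  by_contra! hc
  have hk : ∀ k : ℕ, VerticalEdge P x (y - k) := by
    intro k
    induction k with
    | zero => simpa using h
    | succ k ih =>
      have hv := hc (y - k) (by omega)
      push_cast
      rw [← sub_sub]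
      simp only [IsVertex, VerticalEdge, HorizontalEdge, Xor] at hv ih ⊢
      grind
  obtain ⟨M, hM⟩ := exists_abs_snd_lt P
  have hm : ∃ x', (x', y - ((M + y.natAbs : ℕ) : ℤ)) ∈ P := by
    rcases hk (M + y.natAbs) with h | h
    exacts [⟨_, h.1⟩, ⟨_, h.1⟩]
  obtain ⟨x', hx⟩ := hm
  have := hM _ hx
  simp only [abs_lt] at this
  omega

/-! ### The crossing rule -/

/-- The ordinate of the lattice point that represents the entry of `π` at `i`; the abscissa of this
point is `i + 1`. -/
def height {n : ℕ} (π : Equiv.Perm (Fin n)) (i : Fin n) : ℤ := ((π i : ℕ) : ℤ) + 1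

theorem height_lt_height {n : ℕ} {π : Equiv.Perm (Fin n)} {i j : Fin n} :
    height π i < height π j ↔ π i < π j := by
  simp [height]

/-- The boundary of `P` on the vertical line with abscissa `i + 1` is the single segment that leads, in
the clockwise sense, from the point of `π` on that line to the point of `π₂`. -/
def CrossingRule {n : ℕ} (P : Finset (ℤ × ℤ)) (π π₂ : Equiv.Perm (Fin n)) : Prop :=
  ∀ i : Fin n, height π i ≠ height π₂ i ∧ ∀ y : ℤ,
    (height π i ≤ y → y < height π₂ i → ((i : ℤ) + 1, y) ∈ P ∧ ((i : ℤ), y) ∉ P) ∧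
    (height π₂ i ≤ y → y < height π i → ((i : ℤ), y) ∈ P ∧ ((i : ℤ) + 1, y) ∉ P) ∧
    ((y < height π i ↔ y < height π₂ i) → (((i : ℤ) + 1, y) ∈ P ↔ ((i : ℤ), y) ∈ P))

/-- Of two consecutive sides one is vertical and one horizontal, and the first side, which starts from
the lowest leftmost vertex, is vertical. So the side from a vertex of `π₁` to the next one, which is a
vertex of `π₂`, is vertical. There are no other vertices on its line. -/
theorem IsVertexList.crossingRule {n r : ℕ} {P : Finset (ℤ × ℤ)} {π π₂ : Equiv.Perm (Fin n)}
    {A : Fin (2 * r + 2) → ℤ × ℤ} (hA : IsVertexList P A) (hn : 0 < n) (hP : ∀ c ∈ P, 1 ≤ c.1)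
    (h₁ : {p | ∃ i : Fin (2 * r + 2), Even (i : ℕ) ∧ A i = p} = points π)
    (h₂ : {p | ∃ i : Fin (2 * r + 2), Odd (i : ℕ) ∧ A i = p} = points π₂) :
    CrossingRule P π π₂ := by
  have hm : ∀ i : Fin n, ∃ j : Fin (2 * r + 2), Even (j : ℕ) ∧ A j = ((i : ℤ) + 1, height π i) :=
    fun i => (h₁.ge : points π ⊆ _) ⟨i, rfl⟩
  have heven : ∀ j : Fin (2 * r + 2), Even (j : ℕ) →
      ∃ i : Fin n, A j = ((i : ℤ) + 1, height π i) :=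
    fun j hj => (h₁.le : _ ⊆ points π) ⟨j, hj, rfl⟩
  have hodd : ∀ j : Fin (2 * r + 2), Odd (j : ℕ) →
      ∃ i : Fin n, A j = ((i : ℤ) + 1, height π₂ i) :=
    fun j hj => (h₂.le : _ ⊆ points π₂) ⟨j, hj, rfl⟩
  have hv : ∀ j, IsVertex P (A j) := fun j => (hA.mem_iff _).1 ⟨j, rfl⟩
  have h0 : (A 0).1 = 1 := by
    obtain ⟨j, -, hj⟩ := hm ⟨0, hn⟩
    obtain ⟨i, hi⟩ := heven 0 (by simp)
    have h := hA.leftmost j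
    rw [hj, hi] at h
    rw [hi]
    simp only [Nat.cast_zero, zero_add] at h ⊢
    omega
  have hs0 : (A 0).1 = (A (0 + 1)).1 := by
    rcases (hA.side 0).departure with h | ⟨-, -, h | h⟩
    · exact h.1
    · -- a first side going east would have a cell below it, hence a lower vertex on its left
      have he : VerticalEdge P (A 0).1 ((A 0).2 - 1) := by
        refine Or.inr ⟨h.1, fun hc => ?_⟩
        have := hP _ hc
        simp only at this
        omega
      obtain ⟨y', hy', hv'⟩ := he.exists_vertex_below
      obtain ⟨j, hj⟩ := (hA.mem_iff _).2 hv'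
      have := hA.lowest j (by rw [hj])
      rw [hj] at this
      simp only at this
      omega
    · have := hP _ h.1
      simp only at this
      omega
  have hofNat : ∀ m, Fin.ofNat (2 * r + 2) (m + 1) = Fin.ofNat (2 * r + 2) m + 1 := fun m => by
    ext
    simp [Fin.val_add]
  have hs : ∀ m, IsClockwiseSide P (A (Fin.ofNat _ m)) (A (Fin.ofNat _ (m + 1))) := fun m => by
    rw [hofNat]
    exact hA.side _
  have hvert : ∀ k, (A (Fin.ofNat _ (2 * k))).1 = (A (Fin.ofNat _ (2 * k + 1))).1 := by
    intro k
    induction k with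
    | zero => exact hs0
    | succ k ih =>
      have := (hs (2 * k)).horizontal_of_vertical (hs (2 * k + 1)) (hv _) ih
      exact (hs (2 * k + 1)).vertical_of_horizontal (hs (2 * k + 2)) (hv _) this
  have hside : ∀ i : Fin n,
      IsClockwiseSide P ((i : ℤ) + 1, height π i) ((i : ℤ) + 1, height π₂ i) := by
    intro i
    obtain ⟨j, ⟨k, hk⟩, hj⟩ := hm i
    have hj' : Fin.ofNat _ (2 * k) = j := by
      ext
      simp only [Fin.val_ofNat]
      rw [Nat.mod_eq_of_lt (by omega)]
      omega
    have h := hs (2 * k)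
    have hx := hvert k
    obtain ⟨i', hi'⟩ := hodd (Fin.ofNat _ (2 * k + 1)) (by
      simp only [Fin.val_ofNat]
      rw [Nat.mod_eq_of_lt (by omega)]
      exact odd_two_mul_add_one k)
    rw [hi', hj', hj] at h hx
    have : i' = i := by
      ext
      simp only at hx
      omega
    rwa [this] at h
  intro i
  have hsi := hside i
  refine ⟨?_, fun y => ⟨fun h h' => ?_, fun h h' => ?_, fun h => ?_⟩⟩
  · rcases hsi with h | h | h | h
    · exact h.2.1.ne
    · exact absurd h.2.1 (lt_irrefl _)
    · exact h.2.1.ne'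
    · exact absurd h.2.1 (lt_irrefl _)
  · rcases hsi with hh | hh | hh | hh
    · simpa using hh.2.2 y h h'
    · exact absurd hh.2.1 (lt_irrefl _)
    · exact absurd hh.2.1 (h.trans_lt h').not_gt
    · exact absurd hh.2.1 (lt_irrefl _)
  · rcases hsi with hh | hh | hh | hh
    · exact absurd hh.2.1 (h.trans_lt h').not_gt
    · exact absurd hh.2.1 (lt_irrefl _)
    · simpa using hh.2.2 y h h'
    · exact absurd hh.2.1 (lt_irrefl _)
  · by_contra hc
    have he : VerticalEdge P ((i : ℤ) + 1) y := by
      simp only [VerticalEdge, Xor, add_sub_cancel_right]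
      tauto
    have key : ∀ y', IsVertex P ((i : ℤ) + 1, y') → y' = height π i ∨ y' = height π₂ i := by
      intro y' hy'
      obtain ⟨j, hj⟩ := (hA.mem_iff _).2 hy'
      rcases Nat.even_or_odd (j : ℕ) with hj' | hj'
      · obtain ⟨i', hi'⟩ := heven j hj'
        rw [hj, Prod.mk.injEq] at hi'
        have : i' = i := by
          ext
          omega
        exact Or.inl (this ▸ hi'.2)
      · obtain ⟨i', hi'⟩ := hodd j hj'
        rw [hj, Prod.mk.injEq] at hi'
        have : i' = i := by
          ext
          omega
        exact Or.inr (this ▸ hi'.2)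
    obtain ⟨y₁, hy₁, hv₁⟩ := he.exists_vertex_above
    obtain ⟨y₂, hy₂, hv₂⟩ := he.exists_vertex_below
    rcases key _ hv₁ with h₁ | h₁ <;> rcases key _ hv₂ with h₂ | h₂ <;> omega

/-! ### Convex permutominoes give square permutations -/

/-- A connected `P` misses every set of cells that it cannot leave, unless it lies inside it. -/
theorem EdgeConnected.forall_notMem {P : Finset (ℤ × ℤ)} (hP : EdgeConnected (P : Set (ℤ × ℤ)))
    {Q : ℤ × ℤ → Prop} (h : ∃ c ∈ P, ¬ Q c)
    (hQ : ∀ c ∈ P, ∀ d ∈ P, Q c → CellAdj c d → Q d) : ∀ c ∈ P, ¬ Q c := by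
  intro c hc hcQ
  obtain ⟨d, hd, hdQ⟩ := h
  have hpath : ∀ e, Relation.ReflTransGen (fun a b => CellAdj a b ∧ b ∈ (P : Set (ℤ × ℤ))) c e →
      e ∈ P ∧ Q e := by
    intro e he
    induction he with
    | refl => exact ⟨hc, hcQ⟩
    | tail _ hab ih => exact ⟨hab.2, hQ _ ih.1 _ hab.2 ih.2 hab.1⟩
  exact hdQ (hpath d (hP c hc d hd)).2

/-- The four possible patterns of the cells around a vertex of `π`: the upper two cells differ, the
north-east one being in `P`, and the lower two agree; or the lower two differ, the south-west one being
in `P`, and the upper two agree. -/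
theorem CrossingRule.corner {n : ℕ} {P : Finset (ℤ × ℤ)} {π π₂ : Equiv.Perm (Fin n)}
    (h : CrossingRule P π π₂) (i : Fin n) :
    (((i : ℤ) + 1, height π i) ∈ P ∧ ((i : ℤ), height π i) ∉ P ∧
      (((i : ℤ) + 1, height π i - 1) ∈ P ↔ ((i : ℤ), height π i - 1) ∈ P)) ∨
    (((i : ℤ), height π i - 1) ∈ P ∧ ((i : ℤ) + 1, height π i - 1) ∉ P ∧
      (((i : ℤ) + 1, height π i) ∈ P ↔ ((i : ℤ), height π i) ∈ P)) := by
  obtain ⟨hne, hr⟩ := h i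
  obtain ⟨a₁, a₂, a₃⟩ := hr (height π i)
  obtain ⟨b₁, b₂, b₃⟩ := hr (height π i - 1)
  rcases lt_or_gt_of_ne hne with hlt | hlt
  · exact Or.inl ⟨(a₁ le_rfl hlt).1, (a₁ le_rfl hlt).2, b₃ (by omega)⟩
  · exact Or.inr ⟨(b₂ (by omega) (by omega)).1, (b₂ (by omega) (by omega)).2, a₃ (by omega)⟩

/-- By convexity, one of the four quadrants at a vertex of `π` cannot be left within `P`, so `P` has no
cell there. As every vertex of `π` has a cell of `P` on its south-west or on its north-east, there are
no vertices of `π` in the interior of this quadrant, and the entry is a record. -/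
theorem CrossingRule.isSquarePerm {n : ℕ} {P : Finset (ℤ × ℤ)} {π π₂ : Equiv.Perm (Fin n)}
    (h : CrossingRule P π π₂) (hP : EdgeConnected (P : Set (ℤ × ℤ))) (hrow : IsRowConvex P)
    (hcol : IsColumnConvex P) : IsSquarePerm π := by
  have row : ∀ {x₁ x x₂ y : ℤ}, (x₁, y) ∈ P → (x₂, y) ∈ P → x₁ ≤ x → x ≤ x₂ → (x, y) ∈ P :=
    fun h₁ h₂ h h' => (hrow _).out h₁ h₂ ⟨h, h'⟩
  have col : ∀ {x y₁ y y₂ : ℤ}, (x, y₁) ∈ P → (x, y₂) ∈ P → y₁ ≤ y → y ≤ y₂ → (x, y) ∈ P :=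
    fun h₁ h₂ h h' => (hcol _).out h₁ h₂ ⟨h, h'⟩
  intro i
  have hlt : ∀ {j}, j ≠ i → ¬ π i < π j → height π j < height π i := fun hj h =>
    height_lt_height.2 (lt_of_le_of_ne (not_lt.1 h) fun e => hj (π.injective e))
  have hgt : ∀ {j}, j ≠ i → ¬ π j < π i → height π i < height π j := fun hj h =>
    height_lt_height.2 (lt_of_le_of_ne (not_lt.1 h) fun e => hj (π.injective e.symm))
  rcases h.corner i with ⟨h₁, h₂, h₃⟩ | ⟨h₁, h₂, h₃⟩
  · by_cases h₄ : ((i : ℤ), height π i - 1) ∈ P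
    · -- only the north-west cell is missing
      left; left
      have hQ := hP.forall_notMem (Q := fun c => c.1 ≤ i ∧ height π i ≤ c.2) ⟨_, h₁, by simp⟩ (by
        rintro ⟨x, y⟩ hc d hd ⟨hx, hy⟩ hadj
        simp only at hx hy
        rw [cellAdj_iff] at hadj
        simp only at hadj
        rcases hadj with rfl | rfl | rfl | rfl <;> refine ⟨?_, ?_⟩ <;> simp only <;> by_contra hcon
        all_goals first | omega | skip
        · obtain rfl : x = i := by omega
          exact h₂ (col h₄ hc (by omega) hy)
        · obtain rfl : y = height π i := by omega
          exact h₂ (row hc h₁ hx (by omega)))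
      intro j hj
      by_contra hcon
      have hlt' := hgt hj.ne hcon
      have hj' := Fin.lt_def.1 hj
      rcases h.corner j with hc | hc
      · exact hQ _ hc.1 (by simp only; omega)
      · exact hQ _ hc.1 (by simp only; omega)
    · -- only the north-east cell is present
      right; left
      have hQ := hP.forall_notMem (Q := fun c => c.1 ≤ i ∧ c.2 < height π i) ⟨_, h₁, by simp⟩ (by
        rintro ⟨x, y⟩ hc d hd ⟨hx, hy⟩ hadj
        simp only at hx hy
        rw [cellAdj_iff] at hadj
        simp only at hadj
        rcases hadj with rfl | rfl | rfl | rfl <;> refine ⟨?_, ?_⟩ <;> simp only <;> by_contra hcon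
        all_goals first | omega | skip
        · obtain rfl : x = i := by omega
          exact h₄ (h₃.1 (col hd h₁ (by omega) (by omega)))
        · have hy' : y + 1 = height π i := by omega
          rw [hy'] at hd
          exact h₂ (row hd h₁ hx (by omega)))
      intro j hj
      by_contra hcon
      have hlt' := hlt hj.ne hcon
      have hj' := Fin.lt_def.1 hj
      rcases h.corner j with hc | hc
      · exact hQ _ hc.1 (by simp only; omega)
      · exact hQ _ hc.1 (by simp only; omega)
  · by_cases h₄ : ((i : ℤ), height π i) ∈ P
    · -- only the south-east cell is missing
      right; right
      have hQ := hP.forall_notMem (Q := fun c => i < c.1 ∧ c.2 < height π i) ⟨_, h₁, by simp⟩ (by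
        rintro ⟨x, y⟩ hc d hd ⟨hx, hy⟩ hadj
        simp only at hx hy
        rw [cellAdj_iff] at hadj
        simp only at hadj
        rcases hadj with rfl | rfl | rfl | rfl <;> refine ⟨?_, ?_⟩ <;> simp only <;> by_contra hcon
        all_goals first | omega | skip
        · obtain rfl : x = (i : ℤ) + 1 := by omega
          exact h₂ (col hc (h₃.2 h₄) (by omega) (by omega))
        · obtain rfl : y = height π i - 1 := by omega
          exact h₂ (row h₁ hc (by omega) (by omega)))
      intro j hj
      by_contra hcon
      have hlt' := hlt hj.ne' hcon
      have hj' := Fin.lt_def.1 hj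
      rcases h.corner j with hc | hc
      · exact hQ _ hc.1 (by simp only; omega)
      · exact hQ _ hc.1 (by simp only; omega)
    · -- only the south-west cell is present
      left; right
      have hQ := hP.forall_notMem (Q := fun c => i < c.1 ∧ height π i ≤ c.2) ⟨_, h₁, by simp⟩ (by
        rintro ⟨x, y⟩ hc d hd ⟨hx, hy⟩ hadj
        simp only at hx hy
        rw [cellAdj_iff] at hadj
        simp only at hadj
        rcases hadj with rfl | rfl | rfl | rfl <;> refine ⟨?_, ?_⟩ <;> simp only <;> by_contra hcon
        all_goals first | omega | skip
        · obtain rfl : x = (i : ℤ) + 1 := by omega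
          exact h₄ (col h₁ (by simpa using hd) (by omega) (by omega))
        · obtain rfl : y = height π i := by omega
          exact h₂ (row h₁ hd (by omega) (by omega)))
      intro j hj
      by_contra hcon
      have hlt' := hgt hj.ne' hcon
      have hj' := Fin.lt_def.1 hj
      rcases h.corner j with hc | hc
      · exact hQ _ hc.1 (by simp only; omega)
      · exact hQ _ hc.1 (by simp only; omega)

/-- If the first `m` entries of `π` exceed all the others, a row of `P` through column `m` would extend
to the west beyond column `1` or to the east beyond column `n - 1`. -/
theorem CrossingRule.exists_le_of_column_nonempty {n : ℕ} {P : Finset (ℤ × ℤ)}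
    {π π₂ : Equiv.Perm (Fin n)} (h : CrossingRule P π π₂) (h0 : ∀ y, ((0 : ℤ), y) ∉ P)
    (hn : ∀ y, ((n : ℤ), y) ∉ P) {m : ℕ} (hmn : m ≤ n) {y : ℤ} (hy : ((m : ℤ), y) ∈ P) :
    ∃ i j : Fin n, (i : ℕ) < m ∧ m ≤ (j : ℕ) ∧ π i ≤ π j := by
  by_contra! hc
  by_cases hlow : ∀ i : Fin n, (i : ℕ) < m → y < height π i
  · have hwest : ∀ k ≤ m, ((k : ℤ), y) ∉ P := by
      intro k
      induction k with
      | zero => exact fun _ => by simpa using h0 y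
      | succ k ih =>
        intro hk hmem
        obtain ⟨-, hr⟩ := h ⟨k, by omega⟩
        obtain ⟨-, h₂, h₃⟩ := hr y
        have hlt := hlow ⟨k, by omega⟩ hk
        push_cast at hmem
        by_cases hle : height π₂ ⟨k, by omega⟩ ≤ y
        · exact ih (by omega) (h₂ hle hlt).1
        · exact ih (by omega) ((h₃ (by omega)).1 hmem)
    exact hwest m le_rfl hy
  · push Not at hlow
    obtain ⟨i, him, hi⟩ := hlow
    have heast : ∀ k, m ≤ k → k ≤ n → ((k : ℤ), y) ∈ P := by
      intro k hk
      induction k, hk using Nat.le_induction with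
      | base => exact fun _ => hy
      | succ k hk ih =>
        intro hkn
        obtain ⟨-, hr⟩ := h ⟨k, by omega⟩
        obtain ⟨h₁, -, h₃⟩ := hr y
        have hlt := height_lt_height.2 (hc i ⟨k, by omega⟩ him hk)
        have hmem := ih (by omega)
        push_cast
        by_cases hle : height π₂ ⟨k, by omega⟩ ≤ y
        · exact (h₃ (by omega)).2 hmem
        · exact (h₁ (by omega) (by omega)).1
    exact hn y (heast n hmn le_rfl)

/-! ### Connectedness of cell sets -/

theorem CellAdj.symm {c d : ℤ × ℤ} (h : CellAdj c d) : CellAdj d c := by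
  unfold CellAdj at *
  rwa [abs_sub_comm d.1, abs_sub_comm d.2]

/-- `c` and `d` are joined by a path of cells that belong to `S`, except perhaps `c` itself. -/
abbrev Joined (S : Set (ℤ × ℤ)) (c d : ℤ × ℤ) : Prop :=
  Relation.ReflTransGen (fun c d => CellAdj c d ∧ d ∈ S) c d

theorem Joined.symm {S : Set (ℤ × ℤ)} {c d : ℤ × ℤ} (hc : c ∈ S) (h : Joined S c d) :
    Joined S d c := by
  have : d ∈ S ∧ Joined S d c := by
    induction h with
    | refl => exact ⟨hc, Relation.ReflTransGen.refl⟩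
    | tail _ hab ih => exact ⟨hab.2, ih.2.head ⟨hab.1.symm, ih.1⟩⟩
  exact this.2

theorem joined_vertical_of_le {S : Set (ℤ × ℤ)} {x y y' : ℤ} (hy : y ≤ y')
    (h : ∀ z, y ≤ z → z ≤ y' → (x, z) ∈ S) : Joined S (x, y) (x, y') := by
  induction y', hy using Int.leInduction with
  | base => exact Relation.ReflTransGen.refl
  | succ k hk ih =>
    refine (ih fun z h₁ h₂ => h z h₁ (by omega)).tail ⟨?_, h _ (by omega) le_rfl⟩
    simp [cellAdj_iff]

theorem joined_horizontal_of_le {S : Set (ℤ × ℤ)} {x x' y : ℤ} (hx : x ≤ x')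
    (h : ∀ z, x ≤ z → z ≤ x' → (z, y) ∈ S) : Joined S (x, y) (x', y) := by
  induction x', hx using Int.leInduction with
  | base => exact Relation.ReflTransGen.refl
  | succ k hk ih =>
    refine (ih fun z h₁ h₂ => h z h₁ (by omega)).tail ⟨?_, h _ (by omega) le_rfl⟩
    simp [cellAdj_iff]

theorem joined_vertical {S : Set (ℤ × ℤ)} {x y y' : ℤ}
    (h : ∀ z ∈ Set.uIcc y y', (x, z) ∈ S) : Joined S (x, y) (x, y') := by
  rcases le_total y y' with hy | hy
  · rw [Set.uIcc_of_le hy] at h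
    exact joined_vertical_of_le hy fun z h₁ h₂ => h z ⟨h₁, h₂⟩
  · rw [Set.uIcc_of_ge hy] at h
    exact (joined_vertical_of_le hy fun z h₁ h₂ => h z ⟨h₁, h₂⟩).symm (h y' ⟨le_rfl, hy⟩)

theorem joined_horizontal {S : Set (ℤ × ℤ)} {x x' y : ℤ}
    (h : ∀ z ∈ Set.uIcc x x', (z, y) ∈ S) : Joined S (x, y) (x', y) := by
  rcases le_total x x' with hx | hx
  · rw [Set.uIcc_of_le hx] at h
    exact joined_horizontal_of_le hx fun z h₁ h₂ => h z ⟨h₁, h₂⟩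
  · rw [Set.uIcc_of_ge hx] at h
    exact (joined_horizontal_of_le hx fun z h₁ h₂ => h z ⟨h₁, h₂⟩).symm (h x' ⟨le_rfl, hx⟩)

/-- Connected columns, any two neighbouring ones of which have a row in common, form a connected set. -/
theorem IsColumnConvex.edgeConnected {P : Finset (ℤ × ℤ)} (hcol : IsColumnConvex P) {a b : ℤ}
    (hab : ∀ c ∈ P, a ≤ c.1 ∧ c.1 ≤ b)
    (hP : ∀ x, a ≤ x → x < b → ∃ y, (x, y) ∈ P ∧ (x + 1, y) ∈ P) :
    EdgeConnected (P : Set (ℤ × ℤ)) := by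
  have hv : ∀ {x y y'}, (x, y) ∈ P → (x, y') ∈ P → Joined (P : Set (ℤ × ℤ)) (x, y) (x, y') :=
    fun h h' => joined_vertical fun z hz => (hcol _).uIcc_subset h h' hz
  have key : ∀ {x y x' y'}, x ≤ x' → (x, y) ∈ P → (x', y') ∈ P →
      Joined (P : Set (ℤ × ℤ)) (x, y) (x', y') := by
    intro x y x' y' hx h h'
    induction x', hx using Int.leInduction generalizing y' with
    | base => exact hv h h'
    | succ k hk ih =>
      obtain ⟨z, hz, hz'⟩ := hP k ((hab _ h).1.trans hk)
        (by have := (hab _ h').2; simp only at this; omega)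
      exact ((ih hz).tail ⟨by simp [cellAdj_iff], hz'⟩).trans (hv hz' h')
  rintro ⟨x, y⟩ h ⟨x', y'⟩ h'
  rcases le_total x x' with hx | hx
  · exact key hx h h'
  · exact Joined.symm h' (key hx h' h)

/-- From a cell outside a row-convex `P` one can go straight to the west or straight to the east. -/
theorem IsRowConvex.hasNoHoles {P : Finset (ℤ × ℤ)} (hrow : IsRowConvex P) : HasNoHoles P := by
  obtain ⟨M, hM, hM'⟩ : ∃ M : ℤ, (∀ c ∈ P, -M < c.1 ∧ c.1 < M ∧ c.2 < M) ∧ 0 ≤ M := by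
    refine ⟨(P.sup (fun c => c.1.natAbs + c.2.natAbs) : ℕ) + 1, fun c hc => ?_, by omega⟩
    have : c.1.natAbs + c.2.natAbs ≤ P.sup (fun c => c.1.natAbs + c.2.natAbs) :=
      Finset.le_sup (f := fun c : ℤ × ℤ => c.1.natAbs + c.2.natAbs) hc
    omega
  have hwest : ∀ {x y}, x ≤ -M → (x, y) ∉ P := fun hx hc => by
    have := (hM _ hc).1
    simp only at this
    omega
  have heast : ∀ {x y}, M ≤ x → (x, y) ∉ P := fun hx hc => by
    have := (hM _ hc).2.1
    simp only at this
    omega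
  have hnorth : ∀ {x y}, M ≤ y → (x, y) ∉ P := fun hx hc => by
    have := (hM _ hc).2.2
    simp only at this
    omega
  have key : ∀ c, c ∉ P → Joined {c : ℤ × ℤ | c ∉ P} c (-M, M) := by
    rintro ⟨x, y⟩ hc
    by_cases hl : ∀ z ≤ x, (z, y) ∉ P
    · refine (joined_horizontal (x' := -M) fun z hz => ?_).trans
        (joined_vertical fun z _ => hwest le_rfl)
      rw [Set.mem_uIcc] at hz
      by_cases h : z ≤ -M
      · exact hwest h
      · exact hl z (by omega)
    · push Not at hl
      obtain ⟨w, hw, hwP⟩ := hl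
      refine (joined_horizontal (x' := M) fun z hz => ?_).trans
        ((joined_vertical fun z _ => heast le_rfl).trans
          (joined_horizontal fun z _ => hnorth le_rfl))
      rw [Set.mem_uIcc] at hz
      by_cases h : M ≤ z
      · exact heast h
      · exact fun hzP => hc ((hrow y).out hwP hzP ⟨hw, by omega⟩)
  exact fun c hc d hd => (key c hc).trans (Joined.symm hd (key d hd))

/-! ### The polyomino of a square permutation -/

section

variable {n : ℕ} (π : Equiv.Perm (Fin n))

/-- The entries that give the lower boundary of the polyomino of `π`: the first one, and those that do
not belong to `μ(π)`. -/
def IsBottom (j : Fin n) : Prop := (j : ℕ) = 0 ∨ ¬ InMu π j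

/-- The entry at `j` gives the lower end of column `x`: it is the last lower entry that lies on the
vertical lines `1, …, x`. (The entry at `j` lies on the vertical line `j + 1`.) -/
structure IsBottomAt (x : ℤ) (j : Fin n) : Prop where
  isBottom : IsBottom π j
  lt : (j : ℤ) < x
  le_of_isBottom : ∀ i, IsBottom π i → (i : ℤ) < x → i ≤ j

/-- The entry at `k` gives the upper end of column `x`: it is the first entry of `μ(π)` that lies on the
vertical lines `x + 1, …, n`. -/
structure IsTopAt (x : ℤ) (k : Fin n) : Prop where
  inMu : InMu π k
  le : x ≤ (k : ℤ)
  le_of_inMu : ∀ i, InMu π i → x ≤ (i : ℤ) → k ≤ i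

open Classical in
/-- The polyomino whose column `x` reaches from the height of the last entry of the lower boundary on
the left of this column to the height of the first entry of `μ(π)` on its right. -/
noncomputable def polyominoOf : Finset (ℤ × ℤ) :=
  (Finset.Icc 1 ((n : ℤ) - 1) ×ˢ Finset.Icc 1 ((n : ℤ) - 1)).filter fun c =>
    ∃ j k, IsBottomAt π c.1 j ∧ IsTopAt π c.1 k ∧ height π j ≤ c.2 ∧ c.2 < height π k

variable {π}

theorem inMu_of_val_eq_zero {i : Fin n} (hi : (i : ℕ) = 0) : InMu π i :=
  Or.inl fun j hj => by
    have := Fin.lt_def.1 hj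
    omega

theorem inMu_of_val_add_one_eq {i : Fin n} (hi : (i : ℕ) + 1 = n) : InMu π i :=
  Or.inr fun j hj => by
    have := Fin.lt_def.1 hj
    omega

theorem exists_isBottomAt (hn : 0 < n) {x : ℤ} (hx : 1 ≤ x) : ∃ j, IsBottomAt π x j := by
  classical
  obtain ⟨j, hj, hmax⟩ := Finset.exists_max_image
    (Finset.univ.filter fun j : Fin n => IsBottom π j ∧ (j : ℤ) < x) id
    ⟨⟨0, hn⟩, by
      simp only [Finset.mem_filter, Finset.mem_univ, true_and]
      exact ⟨Or.inl rfl, by omega⟩⟩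
  simp only [Finset.mem_filter, Finset.mem_univ, true_and] at hj hmax
  exact ⟨j, hj.1, hj.2, fun i h h' => hmax i ⟨h, h'⟩⟩

theorem exists_isTopAt {x : ℤ} (hx : x < n) (hn : 0 < n) : ∃ k, IsTopAt π x k := by
  classical
  obtain ⟨j, hj, hmin⟩ := Finset.exists_min_image
    (Finset.univ.filter fun j : Fin n => InMu π j ∧ x ≤ (j : ℤ)) id
    ⟨⟨n - 1, by omega⟩, by
      simp only [Finset.mem_filter, Finset.mem_univ, true_and]
      exact ⟨inMu_of_val_add_one_eq (by simp; omega), by omega⟩⟩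
  simp only [Finset.mem_filter, Finset.mem_univ, true_and] at hj hmin
  exact ⟨j, hj.1, hj.2, fun i h h' => hmin i ⟨h, h'⟩⟩

theorem IsBottomAt.mono {x x' : ℤ} {j j' : Fin n} (h : IsBottomAt π x j) (h' : IsBottomAt π x' j')
    (hx : x ≤ x') : j ≤ j' :=
  h'.le_of_isBottom j h.isBottom (h.lt.trans_le hx)

theorem IsTopAt.mono {x x' : ℤ} {k k' : Fin n} (h : IsTopAt π x k) (h' : IsTopAt π x' k')
    (hx : x ≤ x') : k ≤ k' :=
  h.le_of_inMu k' h'.inMu (hx.trans h'.le)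

theorem mem_polyominoOf {x y : ℤ} : (x, y) ∈ polyominoOf π ↔
    ∃ j k, IsBottomAt π x j ∧ IsTopAt π x k ∧ height π j ≤ y ∧ y < height π k := by
  simp only [polyominoOf, Finset.mem_filter, Finset.mem_product, Finset.mem_Icc,
    and_iff_right_iff_imp]
  rintro ⟨j, k, hj, hk, h₁, h₂⟩
  have := hj.lt
  have := hk.le
  have := (π k).isLt
  unfold height at h₁ h₂
  omega

theorem mem_polyominoOf_iff {x y : ℤ} {j k : Fin n} (hj : IsBottomAt π x j) (hk : IsTopAt π x k) :
    (x, y) ∈ polyominoOf π ↔ height π j ≤ y ∧ y < height π k := by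
  rw [mem_polyominoOf]
  constructor
  · rintro ⟨j', k', hj', hk', h⟩
    rwa [(hj.mono hj' le_rfl).antisymm (hj'.mono hj le_rfl),
      (hk.mono hk' le_rfl).antisymm (hk'.mono hk le_rfl)]
  · exact fun h => ⟨j, k, hj, hk, h⟩

theorem mem_Icc_of_mem_polyominoOf {c : ℤ × ℤ} (hc : c ∈ polyominoOf π) :
    (1 ≤ c.1 ∧ c.1 ≤ (n : ℤ) - 1) ∧ 1 ≤ c.2 ∧ c.2 ≤ (n : ℤ) - 1 := by
  simp only [polyominoOf, Finset.mem_filter, Finset.mem_product, Finset.mem_Icc] at hc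
  exact hc.1

theorem IsBottom.isRecord (hπ : IsSquarePerm π) {j : Fin n} (hj : IsBottom π j) :
    IsLeftRightMin π j ∨ IsRightLeftMin π j := by
  rcases hj with hj | hj
  · exact Or.inl fun i hi => by
      have := Fin.lt_def.1 hi
      omega
  · exact (hπ j).resolve_left hj

/-- Otherwise the entries on the left of column `x` would exceed those on its right. -/
theorem IsBottomAt.height_lt (hπ : IsSquarePerm π) (hd : ¬ IsDirectDifference π) {x : ℤ}
    {j k : Fin n} (hj : IsBottomAt π x j) (hk : IsTopAt π x k) : height π j < height π k := by
  rw [isDirectDifference_iff] at hd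
  rw [height_lt_height]
  have hxj := hj.lt
  have hxk := hk.le
  have hjk : j < k := Fin.lt_def.2 (by omega)
  by_contra hc
  have hkj : π k < π j := lt_of_le_of_ne (not_lt.1 hc) fun e => hjk.ne' (π.injective e)
  have hkR : IsRightLeftMax π k := hk.inMu.resolve_left fun h => hc (h j hjk)
  have hjL : IsLeftRightMin π j :=
    (hj.isBottom.isRecord hπ).resolve_right fun h => hkj.not_gt (h k hjk)
  have hright : ∀ p : Fin n, x ≤ (p : ℤ) → π p ≤ π k := by
    -- the largest entry on the right of the column belongs to `μ(π)`
    obtain ⟨q, hq, hmax⟩ := Finset.exists_max_image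
      (Finset.univ.filter fun p : Fin n => x ≤ (p : ℤ)) π ⟨k, by simpa using hxk⟩
    simp only [Finset.mem_filter, Finset.mem_univ, true_and] at hq hmax
    have hqR : IsRightLeftMax π q := fun p hp =>
      lt_of_le_of_ne (hmax p (hq.trans (by have := Fin.lt_def.1 hp; omega)))
        fun e => hp.ne' (π.injective e)
    have hqk : π q ≤ π k := by
      rcases (hk.le_of_inMu q (Or.inr hqR) hq).eq_or_lt with h | h
      · rw [h]
      · exact (hkR q h).le
    exact fun p hp => (hmax p hp).trans hqk
  have hleft : ∀ p : Fin n, (p : ℤ) < x → π k < π p := by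
    intro p hp
    rcases lt_trichotomy p j with h | h | h
    · exact hkj.trans (hjL p h)
    · rwa [h]
    · have hpm : InMu π p := by
        by_contra hcon
        exact (hj.le_of_isBottom p (Or.inr hcon) hp).not_gt h
      rcases hpm with hm | hm
      · exact hkj.trans (hm j h)
      · exact hm k (Fin.lt_def.2 (by omega))
  refine hd ⟨x.toNat, by omega, by omega, fun i i' hi hi' => ?_⟩
  exact (hright i' (by omega)).trans_lt (hleft i (by omega))

theorem isColumnConvex_polyominoOf : IsColumnConvex (polyominoOf π) := by
  refine fun x => ⟨fun y hy y' hy' z hz => ?_⟩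
  simp only [Set.mem_ofPred_eq] at *
  obtain ⟨j, k, hj, hk, h⟩ := mem_polyominoOf.1 hy
  rw [mem_polyominoOf_iff hj hk] at hy' ⊢
  exact ⟨h.1.trans hz.1, hz.2.trans_lt hy'.2⟩

/-- The entries of `μ(π)` increase and then decrease; the lower entries, being left-right or right-left
minima, decrease and then increase. -/
theorem isRowConvex_polyominoOf (hπ : IsSquarePerm π) : IsRowConvex (polyominoOf π) := by
  refine fun y => ⟨fun x₁ h₁ x₂ h₂ x hx => ?_⟩
  simp only [Set.mem_ofPred_eq] at *
  have hx₁ := (mem_Icc_of_mem_polyominoOf h₁).1.1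
  have hx₂ := (mem_Icc_of_mem_polyominoOf h₂).1.2
  simp only at hx₁ hx₂
  obtain ⟨j₁, k₁, hj₁, hk₁, h₁, h₁'⟩ := mem_polyominoOf.1 h₁
  obtain ⟨j₂, k₂, hj₂, hk₂, h₂, h₂'⟩ := mem_polyominoOf.1 h₂
  obtain ⟨j, hj⟩ := exists_isBottomAt (π := π) j₁.pos (hx₁.trans hx.1)
  obtain ⟨k, hk⟩ := exists_isTopAt (π := π) (x := x) (by have := hx.2; omega) j₁.pos
  refine mem_polyominoOf.2 ⟨j, k, hj, hk, ?_, ?_⟩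
  · rcases hj.isBottom.isRecord hπ with h | h
    · rcases (hj₁.mono hj hx.1).eq_or_lt with e | hlt
      · rwa [← e]
      · exact (height_lt_height.2 (h _ hlt)).le.trans h₁
    · rcases (hj.mono hj₂ hx.2).eq_or_lt with e | hlt
      · rwa [e]
      · exact (height_lt_height.2 (h _ hlt)).le.trans h₂
  · rcases hk.inMu with h | h
    · rcases (hk₁.mono hk hx.1).eq_or_lt with e | hlt
      · rwa [← e]
      · exact h₁'.trans (height_lt_height.2 (h _ hlt))
    · rcases (hk.mono hk₂ hx.2).eq_or_lt with e | hlt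
      · rwa [e]
      · exact h₂'.trans (height_lt_height.2 (h _ hlt))

variable (π) in
/-- The vertical line that carries the entry at `i` is followed, along the boundary in the clockwise
sense, by the one that carries the entry at `i'`: the boundary visits the entries of `μ(π)` from left to
right, then the others from right to left. -/
def IsSucc (i i' : Fin n) : Prop :=
  (InMu π i ∧ (i : ℕ) + 1 ≠ n ∧ IsTopAt π ((i : ℤ) + 1) i') ∨
    ((¬ InMu π i ∨ (i : ℕ) + 1 = n) ∧ IsBottomAt π i i')

/-- On each vertical line just one end of the column changes: the upper one if the entry belongs to
`μ(π)` and the lower one otherwise. -/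
theorem crossingRule_polyominoOf (hπ : IsSquarePerm π) (hd : ¬ IsDirectDifference π)
    {π₂ : Equiv.Perm (Fin n)} (h : ∀ i, ∃ i', IsSucc π i i' ∧ π₂ i = π i') :
    CrossingRule (polyominoOf π) π π₂ := by
  intro i
  obtain ⟨i', hi', he⟩ := h i
  have he' : height π₂ i = height π i' := by simp [height, he]
  rw [he']
  have hne : i ≠ i' := by
    rintro rfl
    rcases hi' with ⟨-, -, h⟩ | ⟨-, h⟩
    · have := h.le
      omega
    · exact lt_irrefl _ h.lt
  have hhne : height π i ≠ height π i' := fun e =>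
    hne (π.injective (Fin.ext (by simpa [height] using e)))
  refine ⟨hhne, fun y => ?_⟩
  rcases hi' with ⟨hmu, hin, htop⟩ | ⟨hmu, hbot⟩
  · by_cases hi0 : (i : ℕ) = 0
    · have hbot : IsBottomAt π ((i : ℤ) + 1) i :=
        ⟨Or.inl hi0, by omega, fun p _ hp => Fin.le_def.2 (by omega)⟩
      have hlt := hbot.height_lt hπ hd htop
      have hl : ((i : ℤ), y) ∉ polyominoOf π := fun hc => by
        have := (mem_Icc_of_mem_polyominoOf hc).1.1
        simp only at this
        omega
      have hr := mem_polyominoOf_iff (y := y) hbot htop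
      grind
    · obtain ⟨j, hj⟩ := exists_isBottomAt (π := π) i.pos (x := i) (by omega)
      have htop' : IsTopAt π (i : ℤ) i := ⟨hmu, le_rfl, fun p _ hp => Fin.le_def.2 (by omega)⟩
      have hj' : IsBottomAt π ((i : ℤ) + 1) j := by
        refine ⟨hj.isBottom, by have := hj.lt; omega, fun p hp hlt => hj.le_of_isBottom p hp ?_⟩
        have hpi : p ≠ i := by
          rintro rfl
          exact hp.elim hi0 fun h => h hmu
        have := Fin.val_ne_iff.2 hpi
        omega
      have hlt := hj.height_lt hπ hd htop'
      have hlt' := hj'.height_lt hπ hd htop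
      have hl := mem_polyominoOf_iff (y := y) hj htop'
      have hr := mem_polyominoOf_iff (y := y) hj' htop
      grind
  · by_cases hin : (i : ℕ) + 1 = n
    · have htop : IsTopAt π (i : ℤ) i :=
        ⟨inMu_of_val_add_one_eq hin, le_rfl, fun p _ hp => Fin.le_def.2 (by omega)⟩
      have hlt := hbot.height_lt hπ hd htop
      have hr : ((i : ℤ) + 1, y) ∉ polyominoOf π := fun hc => by
        have := (mem_Icc_of_mem_polyominoOf hc).1.2
        simp only at this
        omega
      have hl := mem_polyominoOf_iff (y := y) hbot htop
      grind
    · have hmu' := hmu.resolve_right hin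
      obtain ⟨k, hk⟩ := exists_isTopAt (π := π) (x := (i : ℤ) + 1) (by omega) i.pos
      have hbot' : IsBottomAt π ((i : ℤ) + 1) i :=
        ⟨Or.inr hmu', by omega, fun p _ hp => Fin.le_def.2 (by omega)⟩
      have hk' : IsTopAt π (i : ℤ) k := by
        refine ⟨hk.inMu, by have := hk.le; omega, fun p hp hle => hk.le_of_inMu p hp ?_⟩
        have hpi : p ≠ i := by
          rintro rfl
          exact hmu' hp
        have := Fin.val_ne_iff.2 hpi
        omega
      have hlt := hbot.height_lt hπ hd hk'
      have hlt' := hbot'.height_lt hπ hd hk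
      have hl := mem_polyominoOf_iff (y := y) hbot hk'
      have hr := mem_polyominoOf_iff (y := y) hbot' hk
      grind

theorem IsSucc.isClockwiseSide (hπ : IsSquarePerm π) (hd : ¬ IsDirectDifference π)
    {i i' : Fin n} (h : IsSucc π i i') : IsClockwiseSide (polyominoOf π)
      ((i : ℤ) + 1, height π i') ((i' : ℤ) + 1, height π i') := by
  rcases h with ⟨-, -, htop⟩ | ⟨-, hbot⟩
  · have hle := htop.le
    refine Or.inr (Or.inl ⟨rfl, by simp only; omega, fun x hx hx' => ?_⟩)
    simp only at hx hx' ⊢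
    obtain ⟨j, hj⟩ := exists_isBottomAt (π := π) i.pos (x := x) (by omega)
    have htop' : IsTopAt π x i' :=
      ⟨htop.inMu, by omega, fun p hp hxp => htop.le_of_inMu p hp (by omega)⟩
    have hlt := hj.height_lt hπ hd htop'
    rw [mem_polyominoOf_iff hj htop', mem_polyominoOf_iff hj htop']
    omega
  · have hlt := hbot.lt
    refine Or.inr (Or.inr (Or.inr ⟨rfl, by simp only; omega, fun x hx hx' => ?_⟩))
    simp only at hx hx' ⊢
    obtain ⟨k, hk⟩ := exists_isTopAt (π := π) (x := x) (by omega) i.pos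
    have hbot' : IsBottomAt π x i' :=
      ⟨hbot.isBottom, by omega, fun p hp hxp => hbot.le_of_isBottom p hp (by omega)⟩
    have hlt := hbot'.height_lt hπ hd hk
    rw [mem_polyominoOf_iff hbot' hk, mem_polyominoOf_iff hbot' hk]
    omega

theorem isPolyomino_polyominoOf (hn : 2 ≤ n) (hπ : IsSquarePerm π) (hd : ¬ IsDirectDifference π) :
    IsPolyomino (polyominoOf π) := by
  constructor
  · obtain ⟨j, hj⟩ := exists_isBottomAt (π := π) (by omega) (le_refl 1)
    obtain ⟨k, hk⟩ := exists_isTopAt (π := π) (x := 1) (by omega) (by omega)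
    exact ⟨(1, height π j), (mem_polyominoOf_iff hj hk).2 ⟨le_rfl, hj.height_lt hπ hd hk⟩⟩
  · refine isColumnConvex_polyominoOf.edgeConnected (fun c hc => (mem_Icc_of_mem_polyominoOf hc).1)
      fun x hx hx' => ?_
    obtain ⟨j, hj⟩ := exists_isBottomAt (π := π) (by omega) hx
    obtain ⟨k', hk'⟩ := exists_isTopAt (π := π) (x := x + 1) (by omega) (by omega)
    lift x to ℕ using by omega
    have hxn : x < n := by omega
    by_cases hmu : InMu π ⟨x, hxn⟩
    · -- the lower end of the two columns is the same
      have hj' : IsBottomAt π ((x : ℤ) + 1) j := by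
        refine ⟨hj.isBottom, by have := hj.lt; omega, fun p hp hlt => hj.le_of_isBottom p hp ?_⟩
        have hpi : p ≠ ⟨x, hxn⟩ := by
          rintro rfl
          exact hp.elim (fun h => by simp only at h; omega) fun h => h hmu
        have := Fin.val_ne_iff.2 hpi
        simp only at this
        omega
      obtain ⟨k, hk⟩ := exists_isTopAt (π := π) (x := x) (by omega) (by omega)
      exact ⟨height π j, (mem_polyominoOf_iff hj hk).2 ⟨le_rfl, hj.height_lt hπ hd hk⟩,
        (mem_polyominoOf_iff hj' hk').2 ⟨le_rfl, hj'.height_lt hπ hd hk'⟩⟩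
    · -- the upper end of the two columns is the same
      have hk : IsTopAt π (x : ℤ) k' := by
        refine ⟨hk'.inMu, by have := hk'.le; omega, fun p hp hle => hk'.le_of_inMu p hp ?_⟩
        have hpi : p ≠ ⟨x, hxn⟩ := by
          rintro rfl
          exact hmu hp
        have := Fin.val_ne_iff.2 hpi
        simp only at this
        omega
      obtain ⟨j', hj'⟩ := exists_isBottomAt (π := π) (x := (x : ℤ) + 1) (by omega) (by omega)
      have h₁ := hj.height_lt hπ hd hk
      have h₂ := hj'.height_lt hπ hd hk'
      exact ⟨height π k' - 1, (mem_polyominoOf_iff hj hk).2 (by omega),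
        (mem_polyominoOf_iff hj' hk').2 (by omega)⟩

theorem image_fst_polyominoOf (hπ : IsSquarePerm π) (hd : ¬ IsDirectDifference π) :
    (polyominoOf π).image Prod.fst = Finset.Icc (1 : ℤ) ((n : ℤ) - 1) := by
  ext x
  simp only [Finset.mem_image, Prod.exists, exists_and_right, exists_eq_right, Finset.mem_Icc]
  constructor
  · rintro ⟨y, h⟩
    exact (mem_Icc_of_mem_polyominoOf h).1
  · rintro ⟨h₁, h₂⟩
    obtain ⟨j, hj⟩ := exists_isBottomAt (π := π) (by omega) h₁
    obtain ⟨k, hk⟩ := exists_isTopAt (π := π) (x := x) (by omega) (by omega)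
    exact ⟨height π j, (mem_polyominoOf_iff hj hk).2 ⟨le_rfl, hj.height_lt hπ hd hk⟩⟩

/-- The lowest and the highest row contain cells beside the smallest and the largest entry; by
connectedness, so do the rows in between. -/
theorem image_snd_polyominoOf (hn : 2 ≤ n) (hπ : IsSquarePerm π) (hd : ¬ IsDirectDifference π) :
    (polyominoOf π).image Prod.snd = Finset.Icc (1 : ℤ) ((n : ℤ) - 1) := by
  have hd' := hd
  rw [isDirectDifference_iff] at hd'
  have hlow : ∃ x, (x, (1 : ℤ)) ∈ polyominoOf π := by
    obtain ⟨m, hm⟩ := π.surjective ⟨0, by omega⟩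
    have hlast : (m : ℕ) + 1 ≠ n := fun h => hd' ⟨n - 1, by omega, by omega, fun i j hi hj => by
      obtain rfl : j = m := Fin.ext (by omega)
      rw [hm]
      refine lt_of_le_of_ne (Fin.mk_le_of_le_val (Nat.zero_le _)) fun e => ?_
      have := π.injective (hm.trans e)
      subst this
      omega⟩
    have hmin : ∀ i, ¬ π i < π m := fun i h => by
      rw [hm, Fin.lt_def] at h
      simp at h
    have hbot : IsBottomAt π ((m : ℤ) + 1) m := by
      refine ⟨?_, by omega, fun p _ hp => Fin.le_def.2 (by omega)⟩
      by_contra hc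
      simp only [IsBottom, not_or, not_not] at hc
      rcases hc.2 with h | h
      · exact hmin _ (h ⟨0, by omega⟩ (Fin.lt_def.2 (by simp only; omega)))
      · exact hmin _ (h ⟨n - 1, by omega⟩ (Fin.lt_def.2 (by simp only; omega)))
    obtain ⟨k, hk⟩ := exists_isTopAt (π := π) (x := (m : ℤ) + 1) (by omega) (by omega)
    have hlt := hbot.height_lt hπ hd hk
    have h1 : height π m = 1 := by simp [height, hm]
    exact ⟨_, (mem_polyominoOf_iff hbot hk).2 (by omega)⟩
  have hhigh : ∃ x, (x, (n : ℤ) - 1) ∈ polyominoOf π := by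
    obtain ⟨m, hm⟩ := π.surjective ⟨n - 1, by omega⟩
    have hmax : ∀ i, i ≠ m → π i < π m := fun i hi => by
      refine lt_of_le_of_ne ?_ fun e => hi (π.injective e)
      rw [hm, Fin.le_def]
      simp only
      omega
    have hfirst : (m : ℕ) ≠ 0 := fun h => hd' ⟨1, by omega, by omega, fun i j hi hj => by
      obtain rfl : i = m := Fin.ext (by omega)
      refine hmax j ?_
      rintro rfl
      omega⟩
    have htop : IsTopAt π (m : ℤ) m :=
      ⟨Or.inl fun i hi => hmax i hi.ne, le_rfl, fun p _ hp => Fin.le_def.2 (by omega)⟩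
    obtain ⟨j, hj⟩ := exists_isBottomAt (π := π) (x := (m : ℤ)) (by omega) (by omega)
    have hlt := hj.height_lt hπ hd htop
    have h1 : height π m = n := by
      simp only [height, hm]
      omega
    exact ⟨_, (mem_polyominoOf_iff hj htop).2 (by omega)⟩
  ext y
  simp only [Finset.mem_image, Prod.exists, exists_eq_right, Finset.mem_Icc]
  constructor
  · rintro ⟨x, h⟩
    exact (mem_Icc_of_mem_polyominoOf h).2
  · rintro ⟨h₁, h₂⟩
    by_contra! hc
    obtain ⟨x₁, hx₁⟩ := hlow
    obtain ⟨x₂, hx₂⟩ := hhigh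
    have hy : y ≠ 1 := by
      rintro rfl
      exact hc _ hx₁
    refine (isPolyomino_polyominoOf hn hπ hd).2.forall_notMem (Q := fun c => c.2 < y)
      ⟨_, hx₂, by simp only; omega⟩ ?_ _ hx₁ (by simp only; omega)
    rintro ⟨x, z⟩ - ⟨x', z'⟩ hd hz hadj
    have hz' : z' ≠ y := by
      rintro rfl
      exact hc _ hd
    simp only [cellAdj_iff, Prod.mk.injEq] at hz hadj ⊢
    omega

end

/-! ### The vertices of the polyomino in clockwise order -/

/-- A tour of all the entries in the order in which the boundary visits their vertical lines. -/
theorem exists_tour {r : ℕ} (hr : 0 < r) (π : Equiv.Perm (Fin (r + 1))) :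
    ∃ L : Equiv.Perm (Fin (r + 1)), L 0 = 0 ∧ ∀ k, IsSucc π (L k) (L (k + 1)) := by
  classical
  -- sorting by this key puts `μ(π)` first, in increasing order, then the rest, in decreasing order
  let key : Fin (r + 1) → ℕ := fun i => if InMu π i then (i : ℕ) else 2 * (r + 1) - i
  have key_mu : ∀ {i}, InMu π i → key i = i := fun h => if_pos h
  have key_not : ∀ {i}, ¬ InMu π i → key i = 2 * (r + 1) - i := fun h => if_neg h
  have hkey : ∀ i, (InMu π i ∧ key i = i) ∨ (¬ InMu π i ∧ key i = 2 * (r + 1) - i) := fun i => by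
    by_cases h : InMu π i
    · exact Or.inl ⟨h, key_mu h⟩
    · exact Or.inr ⟨h, key_not h⟩
  have hinj : Function.Injective key := fun i j hij => by
    have := i.isLt
    have := j.isLt
    rcases hkey i with hi | hi <;> rcases hkey j with hj | hj <;> ext <;> omega
  have h0mu : InMu π 0 := inMu_of_val_eq_zero rfl
  have hlmu : InMu π (Fin.last r) := inMu_of_val_add_one_eq (by simp)
  have hl := key_mu hlmu
  rw [Fin.val_last] at hl
  have hmono : Monotone (key ∘ Tuple.sort key) := Tuple.monotone_sort key
  have hstrict : StrictMono (key ∘ Tuple.sort key) :=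
    hmono.strictMono_of_injective (hinj.comp (Tuple.sort key).injective)
  have hL0 : Tuple.sort key 0 = 0 := by
    obtain ⟨k, hk⟩ := (Tuple.sort key).surjective 0
    have h : key (Tuple.sort key 0) ≤ key (Tuple.sort key k) := hmono (Fin.zero_le k)
    rw [hk] at h
    refine hinj (le_antisymm h ?_)
    rw [key_mu h0mu]
    simp
  refine ⟨Tuple.sort key, hL0, fun k => ?_⟩
  set i := Tuple.sort key k with hi
  have hilt := i.isLt
  rcases Fin.eq_castSucc_or_eq_last k with ⟨k', rfl⟩ | rfl
  · set i' := Tuple.sort key (k'.castSucc + 1) with hi'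
    have hilt' := i'.isLt
    have hii' : key i < key i' := hstrict (by simp [Fin.lt_def])
    have hbetween : ∀ j, key j ≤ key i ∨ key i' ≤ key j := fun j => by
      obtain ⟨m, rfl⟩ := (Tuple.sort key).surjective j
      rcases le_or_gt m k'.castSucc with h | h
      · exact Or.inl (hmono h)
      · refine Or.inr (hmono ?_)
        rw [Fin.lt_def] at h
        rw [Fin.le_def]
        simp at h ⊢
        omega
    have hbl := hbetween (Fin.last r)
    have hki := hkey i
    have hki' := hkey i'
    by_cases hcase : InMu π i ∧ (i : ℕ) + 1 ≠ r + 1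
    · refine Or.inl ⟨hcase.1, hcase.2, ?_, ?_, fun p hp hip => ?_⟩
      · by_contra hc
        have := key_mu hcase.1
        have := key_not hc
        omega
      · by_cases hm : InMu π i'
        · have := key_mu hcase.1
          have := key_mu hm
          omega
        · have := key_mu hcase.1
          have := key_not hm
          omega
      · have := key_mu hcase.1
        have := key_mu hp
        have := hbetween p
        rw [Fin.le_def]
        omega
    · have hcase' : ¬ InMu π i ∨ (i : ℕ) + 1 = r + 1 := by tauto
      have hm : ¬ InMu π i' := by
        intro hm
        have := key_mu hm
        rcases hcase' with h | h
        · have := key_not h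
          omega
        · omega
      have := key_not hm
      refine Or.inr ⟨hcase', Or.inr hm, ?_, fun p hp hip => ?_⟩
      · rcases hki with h | h
        · have hne : i' ≠ Fin.last r := by
            intro e
            exact hm (e ▸ hlmu)
          have := Fin.val_ne_iff.2 hne
          rw [Fin.val_last] at this
          have := hcase'.resolve_left (not_not.2 h.1)
          omega
        · omega
      · rw [Fin.le_def]
        rcases hp with h | h
        · omega
        · have := key_not h
          have := hbetween p
          rcases hki with h | h
          · omega
          · omega
  · -- the last entry visited is followed by the first entry
    have hmax : ∀ j, key j ≤ key i := fun j => by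
      obtain ⟨m, rfl⟩ := (Tuple.sort key).surjective j
      exact hmono (Fin.le_last m)
    rw [Fin.last_add_one, hL0]
    have hml := hmax (Fin.last r)
    have hki := hkey i
    have hcase : ¬ InMu π i ∨ (i : ℕ) + 1 = r + 1 := by
      rcases hki with h | h
      · right
        omega
      · exact Or.inl h.1
    refine Or.inr ⟨hcase, Or.inl rfl, ?_, fun p hp hip => ?_⟩
    · have : (i : ℕ) ≠ 0 := fun h => by
        have := inMu_of_val_eq_zero (π := π) h
        have := key_mu this
        omega
      simp only [Fin.val_zero]
      omega
    · rw [Fin.le_def]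
      rcases hp with h | h
      · simp [h]
      · have := key_not h
        have := hmax p
        omega

theorem IsClockwiseSide.isVertex_of_turn {P : Finset (ℤ × ℤ)} {p q s : ℤ × ℤ}
    (h₁ : IsClockwiseSide P p q) (h₂ : IsClockwiseSide P q s)
    (h : p.1 = q.1 ∧ q.2 = s.2 ∨ p.2 = q.2 ∧ q.1 = s.1) : IsVertex P q := by
  have a := h₁.arrival
  have b := h₂.departure
  simp only [IsVertex, VerticalEdge, HorizontalEdge, Xor]
  grind

theorem CrossingRule.isClockwiseSide {n : ℕ} {P : Finset (ℤ × ℤ)} {π π₂ : Equiv.Perm (Fin n)}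
    (h : CrossingRule P π π₂) (i : Fin n) :
    IsClockwiseSide P ((i : ℤ) + 1, height π i) ((i : ℤ) + 1, height π₂ i) := by
  obtain ⟨hne, hr⟩ := h i
  rcases lt_or_gt_of_ne hne with hlt | hlt
  · exact Or.inl ⟨rfl, hlt, fun y h₁ h₂ => by simpa using (hr y).1 h₁ h₂⟩
  · exact Or.inr (Or.inr (Or.inl ⟨rfl, hlt, fun y h₁ h₂ => by simpa using (hr y).2.1 h₁ h₂⟩))

/-- The only vertices on a vertical line are the ends of the boundary segment on this line. -/
theorem CrossingRule.eq_or_eq_of_isVertex {n : ℕ} {P : Finset (ℤ × ℤ)} {π π₂ : Equiv.Perm (Fin n)}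
    (h : CrossingRule P π π₂) {i : Fin n} {y : ℤ} (hv : IsVertex P ((i : ℤ) + 1, y)) :
    y = height π i ∨ y = height π₂ i := by
  by_contra! hc
  obtain ⟨hne, hr⟩ := h i
  obtain ⟨a₁, a₂, a₃⟩ := hr y
  obtain ⟨b₁, b₂, b₃⟩ := hr (y - 1)
  simp only [IsVertex, VerticalEdge, HorizontalEdge, Xor, add_sub_cancel_right] at hv
  rcases lt_or_ge y (height π i) with h₁ | h₁ <;> rcases lt_or_ge y (height π₂ i) with h₂ | h₂
  · have a := a₃ (by omega)
    have b := b₃ (by omega)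
    clear a₁ a₂ a₃ b₁ b₂ b₃
    grind
  · have a := a₂ h₂ h₁
    have b := b₂ (by omega) (by omega)
    clear a₁ a₂ a₃ b₁ b₂ b₃
    grind
  · have a := a₁ h₁ h₂
    have b := b₁ (by omega) (by omega)
    clear a₁ a₂ a₃ b₁ b₂ b₃
    grind
  · have a := a₃ (by omega)
    have b := b₃ (by omega)
    clear a₁ a₂ a₃ b₁ b₂ b₃
    grind

/-- If each vertical side leads from `π` to `π₂`, and the horizontal sides lead from one vertical line
to the next along a tour of all of them, then the ends of the vertical sides, taken along the tour, are
the list of the vertices. -/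
theorem CrossingRule.exists_isVertexList {r : ℕ} {P : Finset (ℤ × ℤ)}
    {π π₂ L : Equiv.Perm (Fin (r + 1))} (h : CrossingRule P π π₂) (hr : 0 < r)
    (hP : ∀ c ∈ P, 1 ≤ c.1 ∧ c.1 ≤ r) (hL0 : L 0 = 0) (h0 : height π 0 < height π₂ 0)
    (hlink : ∀ k, π₂ (L k) = π (L (k + 1)))
    (hside : ∀ k, IsClockwiseSide P ((L k : ℤ) + 1, height π (L (k + 1)))
      ((L (k + 1) : ℤ) + 1, height π (L (k + 1)))) :
    ∃ A : Fin (2 * r + 2) → ℤ × ℤ, IsVertexList P A ∧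
      {p | ∃ i : Fin (2 * r + 2), Even (i : ℕ) ∧ A i = p} = points π ∧
      {p | ∃ i : Fin (2 * r + 2), Odd (i : ℕ) ∧ A i = p} = points π₂ := by
  let e : Fin (r + 1) → Fin (2 * r + 2) := fun k => ⟨2 * k, by omega⟩
  let o : Fin (r + 1) → Fin (2 * r + 2) := fun k => ⟨2 * k + 1, by omega⟩
  have heven : ∀ i : Fin (2 * r + 2), Even (i : ℕ) → ∃ k, i = e k := by
    rintro ⟨i, hi⟩ ⟨k, hk⟩
    simp only at hk
    exact ⟨⟨k, by omega⟩, Fin.ext (by simp only [e]; omega)⟩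
  have hodd : ∀ i : Fin (2 * r + 2), Odd (i : ℕ) → ∃ k, i = o k := by
    rintro ⟨i, hi⟩ ⟨k, hk⟩
    simp only at hk
    exact ⟨⟨k, by omega⟩, Fin.ext (by simp only [o]; omega)⟩
  have hcases : ∀ i : Fin (2 * r + 2), ∃ k, i = e k ∨ i = o k := fun i => by
    rcases Nat.even_or_odd (i : ℕ) with hi | hi
    · exact (heven i hi).imp fun _ => Or.inl
    · exact (hodd i hi).imp fun _ => Or.inr
  have hee : ∀ k, Even (e k : ℕ) := fun k => ⟨k, two_mul _⟩
  have hoo : ∀ k, Odd (o k : ℕ) := fun k => ⟨k, rfl⟩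
  have he1 : ∀ k, e k + 1 = o k := fun k => by
    ext
    simp only [e, o, Fin.val_add, Fin.val_one]
    exact Nat.mod_eq_of_lt (by omega)
  have ho1 : ∀ k, o k + 1 = e (k + 1) := fun k => by
    have h1 : ((1 : Fin (r + 1)) : ℕ) = 1 := by
      rw [Fin.val_one', Nat.mod_eq_of_lt (by omega)]
    ext
    simp only [e, o, Fin.val_add, Fin.val_one, h1]
    rw [← Nat.mul_mod_mul_left]
    rfl
  let A : Fin (2 * r + 2) → ℤ × ℤ := fun i =>
    ((L ⟨(i : ℕ) / 2, by omega⟩ : ℤ) + 1,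
      if (i : ℕ) % 2 = 0 then height π (L ⟨(i : ℕ) / 2, by omega⟩)
        else height π₂ (L ⟨(i : ℕ) / 2, by omega⟩))
  have hAe : ∀ k, A (e k) = ((L k : ℤ) + 1, height π (L k)) := fun k => by
    simp [A, e]
  have hAo : ∀ k, A (o k) = ((L k : ℤ) + 1, height π₂ (L k)) := fun k => by
    have h1 : (2 * (k : ℕ) + 1) / 2 = k := by omega
    simp [A, o, h1, Nat.add_mod]
  have hh : ∀ k, height π₂ (L k) = height π (L (k + 1)) := fun k => by simp [height, hlink]
  have hse : ∀ k, IsClockwiseSide P (A (e k)) (A (o k)) := fun k => by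
    rw [hAe, hAo]
    exact h.isClockwiseSide (L k)
  have hso : ∀ k, IsClockwiseSide P (A (o k)) (A (e (k + 1))) := fun k => by
    rw [hAe, hAo, hh]
    exact hside k
  refine ⟨A, ⟨?_, fun p => ⟨?_, fun hp => ?_⟩, fun i => ?_, fun i => ?_, fun i hi => ?_⟩, ?_, ?_⟩
  · intro i j hij
    obtain ⟨k, hk⟩ := hcases i
    obtain ⟨m, hm⟩ := hcases j
    have hx : ∀ a b : Fin (r + 1), ((L a : ℤ) + 1) = (L b : ℤ) + 1 → a = b := fun a b hab =>
      L.injective (Fin.ext (by omega))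
    rcases hk with rfl | rfl <;> rcases hm with rfl | rfl <;>
      simp only [hAe, hAo, Prod.mk.injEq] at hij
    · rw [hx _ _ hij.1]
    · obtain rfl := hx _ _ hij.1
      exact absurd hij.2 (h _).1
    · obtain rfl := hx _ _ hij.1
      exact absurd hij.2.symm (h _).1
    · rw [hx _ _ hij.1]
  · rintro ⟨i, rfl⟩
    obtain ⟨k, rfl | rfl⟩ := hcases i
    · have := hso (k - 1)
      rw [sub_add_cancel] at this
      refine this.isVertex_of_turn (hse k) (Or.inr ⟨?_, ?_⟩)
      · rw [hAe, hAo, hh, sub_add_cancel]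
      · rw [hAe, hAo]
    · refine (hse k).isVertex_of_turn (hso k) (Or.inl ⟨?_, ?_⟩)
      · rw [hAe, hAo]
      · rw [hAe, hAo, hh]
  · obtain ⟨x, y⟩ := p
    have hx : 1 ≤ x ∧ x ≤ r + 1 := by
      have hc : ∃ z, (x, z) ∈ P ∨ (x - 1, z) ∈ P := by
        rcases hp.1 with (h | h) | (h | h)
        exacts [⟨_, Or.inr h.1⟩, ⟨_, Or.inl h.1⟩, ⟨_, Or.inr h.1⟩, ⟨_, Or.inl h.1⟩]
      obtain ⟨z, hz | hz⟩ := hc <;> have := hP _ hz <;> simp only at this <;> omega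
    obtain ⟨i, rfl⟩ : ∃ i : Fin (r + 1), x = (i : ℤ) + 1 :=
      ⟨⟨(x - 1).toNat, by omega⟩, by simp only; omega⟩
    obtain ⟨k, rfl⟩ := L.surjective i
    rcases h.eq_or_eq_of_isVertex hp with rfl | rfl
    · exact ⟨e k, hAe k⟩
    · exact ⟨o k, hAo k⟩
  · obtain ⟨k, rfl | rfl⟩ := hcases i
    · rw [he1]
      exact hse k
    · rw [ho1]
      exact hso k
  · have : A 0 = A (e 0) := rfl
    rw [this, hAe, hL0]
    simp [A]
  · have h00 : A 0 = A (e 0) := rfl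
    rw [h00, hAe, hL0] at hi ⊢
    have hk : ∀ k, (L k : ℤ) + 1 = ((0 : Fin (r + 1)) : ℤ) + 1 → L k = 0 := fun k hk =>
      Fin.ext (by omega)
    obtain ⟨k, rfl | rfl⟩ := hcases i
    · rw [hAe] at hi ⊢
      rw [hk k hi]
    · rw [hAo] at hi ⊢
      rw [hk k hi]
      exact h0.le
  · ext p
    constructor
    · rintro ⟨i, hi, rfl⟩
      obtain ⟨k, rfl⟩ := heven i hi
      exact ⟨L k, hAe k⟩
    · rintro ⟨i, rfl⟩
      obtain ⟨k, rfl⟩ := L.surjective i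
      exact ⟨e k, hee k, hAe k⟩
  · ext p
    constructor
    · rintro ⟨i, hi, rfl⟩
      obtain ⟨k, rfl⟩ := hodd i hi
      exact ⟨L k, hAo k⟩
    · rintro ⟨i, rfl⟩
      obtain ⟨k, rfl⟩ := L.surjective i
      exact ⟨o k, hoo k, hAo k⟩

/-! ### The characterization -/

theorem mem_convexPermutominoPerms_of_isSquarePerm {n : ℕ} (hn : 2 ≤ n) {π : Equiv.Perm (Fin n)}
    (hπ : IsSquarePerm π) (hd : ¬ IsDirectDifference π) : π ∈ convexPermutominoPerms n := by
  obtain ⟨r, rfl⟩ : ∃ r, n = r + 1 := ⟨n - 1, by omega⟩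
  have hr : 0 < r := by omega
  obtain ⟨L, hL0, hL⟩ := exists_tour hr π
  let π₂ : Equiv.Perm (Fin (r + 1)) := ((L.symm.trans (Equiv.addRight 1)).trans L).trans π
  have hlink : ∀ k, π₂ (L k) = π (L (k + 1)) := fun k => by simp [π₂]
  have hrule : CrossingRule (polyominoOf π) π π₂ := crossingRule_polyominoOf hπ hd fun i => by
    obtain ⟨k, rfl⟩ := L.surjective i
    exact ⟨_, hL k, hlink k⟩
  have h0 : height π 0 < height π₂ 0 := by
    -- otherwise there would be a cell on the left of the first vertical line
    refine lt_of_not_ge fun hle => ?_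
    have hc := (((hrule 0).2 (height π₂ 0)).2.1 le_rfl
      (lt_of_le_of_ne hle (hrule 0).1.symm)).1
    have := (mem_Icc_of_mem_polyominoOf hc).1.1
    simp at this
  obtain ⟨A, hA⟩ := hrule.exists_isVertexList hr
    (fun c hc => by simpa using (mem_Icc_of_mem_polyominoOf hc).1) hL0 h0 hlink
    fun k => (hL k).isClockwiseSide hπ hd
  have hrow := isRowConvex_polyominoOf hπ
  exact ⟨polyominoOf π, π₂, Or.inr ⟨isPolyomino_polyominoOf hn hπ hd, hrow.hasNoHoles,
    image_fst_polyominoOf hπ hd, image_snd_polyominoOf hn hπ hd, r, A, hA⟩, hrow,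
    isColumnConvex_polyominoOf⟩

theorem IsPermutomino.isSquarePerm_and_not_isDirectDifference {n : ℕ} (hn : 2 ≤ n)
    {P : Finset (ℤ × ℤ)} {π π₂ : Equiv.Perm (Fin n)} (h : IsPermutomino P π π₂)
    (hrow : IsRowConvex P) (hcol : IsColumnConvex P) :
    IsSquarePerm π ∧ ¬ IsDirectDifference π := by
  obtain ⟨-, h1⟩ | ⟨hP, -, hfst, -, r, A, hA, h₁, h₂⟩ := h
  · omega
  have hx : ∀ x, (∃ y, (x, y) ∈ P) ↔ 1 ≤ x ∧ x ≤ (n : ℤ) - 1 := fun x => by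
    rw [← Finset.mem_Icc, ← hfst]
    simp
  have hrule := hA.crossingRule (by omega) (fun c hc => ((hx c.1).1 ⟨c.2, hc⟩).1) h₁ h₂
  refine ⟨hrule.isSquarePerm hP.2 hrow hcol, fun hd => ?_⟩
  obtain ⟨m, hm, hmn, hlt⟩ := (isDirectDifference_iff π).1 hd
  obtain ⟨y, hy⟩ := (hx m).2 (by omega)
  obtain ⟨i, j, hi, hj, hij⟩ := hrule.exists_le_of_column_nonempty
    (fun y hy => by have := (hx 0).1 ⟨y, hy⟩; omega)
    (fun y hy => by have := (hx n).1 ⟨y, hy⟩; omega) hmn.le hy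
  exact (hlt i j hi hj).not_ge hij

end Permutomino

theorem mainTheorem1 (n : ℕ) (hn : 1 ≤ n) (π : Equiv.Perm (Fin n)) :
    π ∈ Permutomino.convexPermutominoPerms n ↔
      Permutomino.LowerUnimodal (Permutomino.sigma π) ∧ ¬ Permutomino.IsDirectDifference π := by
  rw [Permutomino.lowerUnimodal_sigma_iff_isSquarePerm]
  rcases hn.eq_or_lt with rfl | hn
  · refine iff_of_true ⟨∅, π, Or.inl ⟨rfl, rfl⟩, ?_, ?_⟩ ⟨?_, ?_⟩
    · exact fun y => ⟨fun x hx => by simp at hx⟩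
    · exact fun x => ⟨fun y hy => by simp at hy⟩
    · exact fun j => Or.inl (Permutomino.inMu_of_val_eq_zero (by omega))
    · rintro ⟨m, m', hm, hm', h, -⟩
      omega
  · constructor
    · rintro ⟨P, π₂, hP, hrow, hcol⟩
      exact hP.isSquarePerm_and_not_isDirectDifference hn hrow hcol
    · exact fun h => Permutomino.mem_convexPermutominoPerms_of_isSquarePerm hn h.1 h.2
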